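/- A finite set of system qubits is coupled to a bath (an arbitrary Hilbert space). During a time interval $[0,T]$ the joint system evolves under the Hamiltonian $H(t)=H_S(t)+H_B(t)+H_{SB}(t)$. Here $H_S(t)$ realizes an ideal quantum circuit: a finite set of locations, each an operation on a set of qubits during a time interval of length at most $t_0$ (the maximal duration of a location), such that no qubit takes part in two locations at the same time; $H_S(t)$ is the sum of the Hamiltonians of the locations being executed at time $t$. The self-adjoint bath Hamiltonian $H_B(t)$ is unrestricted (apart from generating, together with $H_S$, a unitary evolution $U_0$). The coupling is $$H_{SB}(t)=\sum_{k\ge 1}\frac1{k!}\sum_{i_1,\dots,i_k}H^{(k)}_{i_1,\dots,i_k}(t),$$ where the bounded, measurable in time, Hermitian operator $H^{(k)}_{i_1,\dots,i_k}(t)$ acts on the $k$ qubits $i_1,\dots,i_k$ and arbitrarily on the bath, is invariant under permutations of the indices, and vanishes if two indices coincide. Expand the evolution operator over $[0,T]$ to all orders in powers of $H_{SB}$ (Dyson series around $U_0$). For a set $\mathcal I_r$ of $r$ locations let $E(\mathcal I_r)$ be the sum of all terms of the expansion in which every location in $\mathcal I_r$ is faulty, i.e. at least one of its qubits is acted on by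 at least one inserted term of $H_{SB}$ during the execution of the location. The noise has effective noise strength $\varepsilon$ if $\|E(\mathcal I_r)\|\le\varepsilon^r$ for every $r\ge 0$ and every set $\mathcal I_r$ of $r$ locations. Let $$\alpha=\max_{k\ge1}\Big(\max_{i_1,\,t}\ \sum_{i_2,\dots,i_k}\big\|H^{(k)}_{i_1,i_2,\dots,i_k}(t)\big\|\,t_0\Big)^{1/k},$$ the inner maximum (supremum) being over all system qubits $i_1$ and all times $t\in[0,T]$ and the sum over all system qubits, and suppose that $2\alpha<1$. If each location acts on at most $m$ qubits, then every $E(\mathcal I_r)$ is well defined (the expansion converges) and the noise has effective noise strength $$\varepsilon= 2m\alpha\,\big(e^{(e-1)/2}\big)^{C(\alpha)},\qquad C(\alpha)=(1-2\alpha)^{-1}.$$ (Since $\|E(\mathcal I_r)\|\le\varepsilon^r$ is an upper bound, this is the assertion that the effective noise strength is at most this number.) As $\alpha\to0^+$ this bound divided by $\alpha$ tends to $2e^{(e-1)/2}\,m$, where $|2e^{(e-1)/2}-4.72|<0.005$. -/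

import Mathlib

open Filter Topology MeasureTheory

namespace CorrelatedNoise

noncomputable section

/-- The joint Hilbert space `(ℂ²)^{⊗ Q} ⊗ B` of the system qubits `Q` and the bath `B`, written
in the computational basis: a vector is a `B`-valued function of the bit string `x : Q → Bool`,
with the `ℓ²` norm. -/
abbrev JointSpace (Q B : Type*) [Fintype Q] [DecidableEq Q] [NormedAddCommGroup B]
    [InnerProductSpace ℂ B] : Type _ :=
  PiLp 2 (fun _ : Q → Bool => B)

/-- Bounded operators on the joint Hilbert space. -/
abbrev JointOp (Q B : Type*) [Fintype Q] [DecidableEq Q] [NormedAddCommGroup B]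
    [InnerProductSpace ℂ B] : Type _ :=
  JointSpace Q B →L[ℂ] JointSpace Q B

/-- The system operator `M ⊗ 1`, where `M` is an operator of the qubits in `S` and `1` is the
identity of the other system qubits. -/
def embedMatrix {Q : Type*} [Fintype Q] [DecidableEq Q] (S : Finset Q)
    (M : Matrix (S → Bool) (S → Bool) ℂ) : Matrix (Q → Bool) (Q → Bool) ℂ :=
  fun x y => if ∀ q, q ∉ S → x q = y q then M (fun q => x q) (fun q => y q) else 0

/-- `A` acts only on the qubits in `S`, and arbitrarily on the bath: `A = K ⊗ 1`, where `K` is an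
operator of the qubits in `S` and the bath (given by its blocks `K x y : B →L[ℂ] B`), and `1` is
the identity of the system qubits outside `S`. -/
def ActsOn {Q B : Type*} [Fintype Q] [DecidableEq Q] [NormedAddCommGroup B]
    [InnerProductSpace ℂ B] (S : Finset Q) (A : JointOp Q B) : Prop :=
  ∃ K : (S → Bool) → (S → Bool) → (B →L[ℂ] B), ∀ (ψ : JointSpace Q B) (x : Q → Bool),
    A ψ x = ∑ y : Q → Bool,
      if ∀ q, q ∉ S → x q = y q then K (fun q => x q) (fun q => y q) (ψ y) else 0

/-- An ideal quantum circuit on the qubits `Q`, with set of locations `L`, run during the time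
interval `[0, T]`. A location is an operation (a gate on one or several qubits, the evolution that
follows a preparation or precedes a measurement, or an idle step) on a set of qubits during a time
interval; no qubit takes part in two locations at the same time. The operation is driven by a
time-dependent Hamiltonian of the qubits of the location. -/
structure Circuit (Q L : Type*) where
  /-- total running time -/
  T : ℝ
  T_nonneg : 0 ≤ T
  /-- the qubits on which a location acts -/
  qubits : L → Finset Q
  /-- the time at which a location starts -/
  start : L → ℝ
  /-- the time at which a location ends -/
  finish : L → ℝ
  start_nonneg : ∀ l, 0 ≤ start l
  start_le_finish : ∀ l, start l ≤ finish l
  finish_le : ∀ l, finish l ≤ T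
  disjoint : ∀ l l', l ≠ l' → ∀ q, q ∈ qubits l → q ∈ qubits l' →
    Disjoint (Set.Ico (start l) (finish l)) (Set.Ico (start l') (finish l'))
  /-- the Hamiltonian that drives a location -/
  gate : (l : L) → ℝ → Matrix (qubits l → Bool) (qubits l → Bool) ℂ
  gate_hermitian : ∀ l t, (gate l t).IsHermitian

namespace Circuit

variable {Q L : Type*}

/-- The time interval during which a location is executed. -/
def window (C : Circuit Q L) (l : L) : Set ℝ := Set.Ico (C.start l) (C.finish l)

/-- The maximal duration `t₀` of a location. -/
def maxDuration (C : Circuit Q L) : ℝ := ⨆ l, (C.finish l - C.start l)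

/-- The system Hamiltonian `H_S(t)`: the sum of the Hamiltonians of the locations that are being
executed at time `t`. -/
def systemHamiltonian [Fintype Q] [DecidableEq Q] [Fintype L] (C : Circuit Q L) (t : ℝ) :
    Matrix (Q → Bool) (Q → Bool) ℂ :=
  ∑ l, (C.window l).indicator (fun s => embedMatrix (C.qubits l) (C.gate l s)) t

end Circuit

/-- The noise: a bath Hamiltonian `H_B(t)`, any self-adjoint, possibly unbounded operator of the
bath, and a system-bath Hamiltonian `H_SB(t) = ∑_S H_S(t)`, summed over the nonempty sets `S` of
system qubits, where the Hermitian operator `H_S(t)` acts on the qubits in `S` and on the bath.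
The value of `coupling` at the empty set is not used. -/
structure Noise (Q B : Type*) [Fintype Q] [DecidableEq Q] [NormedAddCommGroup B]
    [InnerProductSpace ℂ B] [CompleteSpace B] where
  bath : ℝ → (B →ₗ.[ℂ] B)
  bath_selfAdjoint : ∀ t, IsSelfAdjoint (bath t)
  coupling : Finset Q → ℝ → JointOp Q B
  coupling_selfAdjoint : ∀ S t, IsSelfAdjoint (coupling S t)
  coupling_actsOn : ∀ S t, ActsOn S (coupling S t)
  coupling_measurable : ∀ S, StronglyMeasurable (coupling S)
  coupling_bounded : ∀ S, ∃ K : ℝ, ∀ t, ‖coupling S t‖ ≤ K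

/-- `H_S ⊗ 1 + 1 ⊗ H_B`, an operator defined on the vectors all of whose components lie in the
domain of `H_B`. -/
def freeHamiltonian {Q B : Type*} [Fintype Q] [DecidableEq Q] [NormedAddCommGroup B]
    [InnerProductSpace ℂ B] (HS : Matrix (Q → Bool) (Q → Bool) ℂ) (HB : B →ₗ.[ℂ] B) :
    JointSpace Q B →ₗ.[ℂ] JointSpace Q B where
  domain :=
    { carrier := {ψ | ∀ x, ψ x ∈ HB.domain}
      add_mem' := fun ha hb x => HB.domain.add_mem (ha x) (hb x)
      zero_mem' := fun _ => HB.domain.zero_mem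
      smul_mem' := fun c _ h x => HB.domain.smul_mem c (h x) }
  toFun :=
    { toFun := fun ψ => WithLp.toLp 2 (fun x =>
        (∑ y, HS x y • ψ.1 y) + HB ⟨ψ.1 x, ψ.2 x⟩)
      map_add' := by
        intro a b
        ext x
        have h : HB ⟨(a + b).1 x, (a + b).2 x⟩
            = HB ⟨a.1 x, a.2 x⟩ + HB ⟨b.1 x, b.2 x⟩ := by
          rw [← HB.map_add]
          rfl
        have h' : ∑ y, HS x y • (a + b).1 y = ∑ y, HS x y • a.1 y + ∑ y, HS x y • b.1 y := by
          simp only [PiLp.add_apply, Submodule.coe_add, smul_add, Finset.sum_add_distrib]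
        change (∑ y, HS x y • (a + b).1 y) + HB ⟨(a + b).1 x, (a + b).2 x⟩
          = ((∑ y, HS x y • a.1 y) + HB ⟨a.1 x, a.2 x⟩)
            + ((∑ y, HS x y • b.1 y) + HB ⟨b.1 x, b.2 x⟩)
        rw [h, h']
        abel
      map_smul' := by
        intro c a
        ext x
        have h : HB ⟨(c • a).1 x, (c • a).2 x⟩ = c • HB ⟨a.1 x, a.2 x⟩ := by
          rw [← HB.map_smul]
          rfl
        have h' : ∑ y, HS x y • (c • a).1 y = c • ∑ y, HS x y • a.1 y := by
          simp only [PiLp.smul_apply, Submodule.coe_smul, Finset.smul_sum, smul_comm c]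
        change (∑ y, HS x y • (c • a).1 y) + HB ⟨(c • a).1 x, (c • a).2 x⟩
          = c • ((∑ y, HS x y • a.1 y) + HB ⟨a.1 x, a.2 x⟩)
        rw [h, h', smul_add] }

/-- `U t` is the unitary time evolution from time `0` to time `t` that the time-dependent, possibly
unbounded Hamiltonian `H t` generates: it is strongly continuous and, for a dense set of initial
vectors and at all but countably many times (at which the Hamiltonian may be switched), it solves
the Schrödinger equation `dψ/dt = -i H(t) ψ`. -/
structure IsEvolution {E : Type*} [NormedAddCommGroup E] [InnerProductSpace ℂ E] [CompleteSpace E]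
    (H : ℝ → (E →ₗ.[ℂ] E)) (U : ℝ → (E →L[ℂ] E)) : Prop where
  unitary_mem : ∀ t, U t ∈ unitary (E →L[ℂ] E)
  map_zero : U 0 = 1
  continuous : ∀ ψ, Continuous fun t => U t ψ
  schrodinger : ∃ D : Set E, Dense D ∧ ∃ Z : Set ℝ, Z.Countable ∧ ∀ ψ ∈ D, ∀ t ∉ Z,
    ∃ h : U t ψ ∈ (H t).domain,
      HasDerivAt (fun s => U s ψ) (-Complex.I • (H t) ⟨U t ψ, h⟩) t

section Expansion

variable {Q L B : Type*} [Fintype Q] [DecidableEq Q] [NormedAddCommGroup B]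
  [InnerProductSpace ℂ B] [CompleteSpace B]

/-- The labels of the terms in an expansion in powers of `H_SB`: the order `n`, and for each of
the `n` insertions of `H_SB` the nonempty set `S` of system qubits that labels the term of `H_SB`
inserted there. -/
abbrev Word (Q : Type*) : Type _ := Σ n : ℕ, (Fin n → {S : Finset Q // S.Nonempty})

/-- Location `l` is faulty if at least one of its qubits is struck by an insertion during the
execution of `l`; the insertion number `j` is the term `w.2 j` at time `t j`. -/
def Faulty (C : Circuit Q L) (w : Word Q) (t : Fin w.1 → ℝ) (l : L) : Prop :=
  ∃ j, t j ∈ C.window l ∧ ((w.2 j : Finset Q) ∩ C.qubits l).Nonempty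

/-- The ordered insertion times `t₁ < ⋯ < tₙ` in `[0, T]` for which every location in `I` is
faulty. -/
def faultyTimes (C : Circuit Q L) (I : Finset L) (w : Word Q) : Set (Fin w.1 → ℝ) :=
  {t | StrictMono t ∧ (∀ j, t j ∈ Set.Icc 0 C.T) ∧ ∀ l ∈ I, Faulty C w t l}

/-- The term `H_S` of `H_SB` in the interaction picture of the unperturbed evolution `U₀`. -/
def interactionPicture (N : Noise Q B) (U₀ : ℝ → JointOp Q B) (S : Finset Q) (t : ℝ) :
    JointOp Q B :=
  ContinuousLinearMap.adjoint (U₀ t) * N.coupling S t * U₀ t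

/-- The integrand of the expansion of the evolution operator over `[0, T]` in powers of `H_SB`:
`(-i)ⁿ U₀(T) H̃_{Sₙ}(tₙ) ⋯ H̃_{S₁}(t₁)`. -/
def dysonIntegrand (C : Circuit Q L) (N : Noise Q B) (U₀ : ℝ → JointOp Q B) (w : Word Q)
    (t : Fin w.1 → ℝ) : JointOp Q B :=
  (-Complex.I) ^ w.1 •
    (U₀ C.T * (List.ofFn fun j => interactionPicture N U₀ (w.2 j) (t j)).reverse.prod)

/-- `E` is the sum `E(I)` of all terms in the expansion of the evolution operator in powers of
`H_SB`, to all orders, for which every location in `I` is faulty. (All integrals and sums converge,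
unconditionally, on each vector; hence this determines `E`.) -/
def IsFaultSum (C : Circuit Q L) (N : Noise Q B) (U₀ : ℝ → JointOp Q B) (I : Finset L)
    (E : JointOp Q B) : Prop :=
  ∀ ψ : JointSpace Q B,
    (∀ w : Word Q, IntegrableOn (fun t => dysonIntegrand C N U₀ w t ψ) (faultyTimes C I w)) ∧
    HasSum (fun w : Word Q => ∫ t in faultyTimes C I w, dysonIntegrand C N U₀ w t ψ) (E ψ)

/-- The noise has effective noise strength `ε`: for every set `I` of `r` locations the operator
`E(I)` exists and `‖E(I)‖ ≤ ε ^ r`. -/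
def HasEffectiveNoiseStrength (C : Circuit Q L) (N : Noise Q B) (U₀ : ℝ → JointOp Q B) (ε : ℝ) :
    Prop :=
  ∀ I : Finset L, ∃ E : JointOp Q B, IsFaultSum C N U₀ I E ∧ ‖E‖ ≤ ε ^ I.card

/-- The coupling `H^{(k)}_{i₁,…,i_k}(t)` with ordered indices: invariant under permutations of the
indices, and zero if two of them coincide. -/
def tupleCoupling (N : Noise Q B) {k : ℕ} (i : Fin k → Q) (t : ℝ) : JointOp Q B :=
  if Function.Injective i then N.coupling (Finset.univ.image i) t else 0

/-- For `k = n + 1`, the number `max_{i₁} ∑_{i₂,…,i_k} ‖H^{(k)}_{i₁,i₂,…,i_k}‖ t₀`, where the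
maximum (supremum) is over all system qubits `i₁` and all times in `[0, T]`. -/
def couplingStrength (C : Circuit Q L) (N : Noise Q B) (n : ℕ) : ℝ :=
  ⨆ p : Q × Set.Icc (0 : ℝ) C.T,
    (∑ i : Fin n → Q, ‖tupleCoupling N (Fin.cons p.1 i : Fin (n + 1) → Q) p.2‖) * C.maxDuration

/-- `α = max_{k ≥ 1} (max_{i₁} ∑_{i₂,…,i_k} ‖H^{(k)}_{i₁,i₂,…,i_k}‖ t₀)^{1/k}`, with
`k = n + 1`. -/
def alpha (C : Circuit Q L) (N : Noise Q B) : ℝ :=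
  ⨆ n : ℕ, couplingStrength C N n ^ (1 / ((n : ℝ) + 1))

end Expansion

/-- `2 m α (e^{(e-1)/2})^{C(α)}` with `C(α) = (1 - 2 α)⁻¹`. -/
def strengthBound (m : ℕ) (α : ℝ) : ℝ :=
  2 * m * α * Real.exp ((Real.exp 1 - 1) / 2) ^ (1 - 2 * α)⁻¹

end

end CorrelatedNoise

/-! In the interaction picture every inserted operator is `-i` times a Hermitian one, and `U₀(T)` in
front does not change norms. Let `x_I(t)` be the sum of the Dyson terms up to time `t` that hit all
locations in `I`, applied to `ψ`. Splitting off the last insertion gives `x_I' = ∑_S A_S x_{I \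
hits(S)}` (`isPrimitive_total`), since the earlier insertions only have to hit what the last one
missed. The insertions that hit nothing in `I` contribute `A_S x_I`, which is orthogonal to `x_I` in
the real sense and so does not change `‖x_I‖`. Hence only hits in `I` make the norm grow, and no
factor depending on the size of the circuit appears.

By induction on `I`, `‖x_I‖ ≤ ∏_{l ∈ I} h_l ‖ψ‖` with `h_l = δ + ∫ rate_l`
(`norm_total_le_prod_majorant`). An insertion of `S` that hits `k` locations deletes `k` factors,
while the product rule deletes only one. The other `k - 1` factors are at least `δ`, so a weight `ρ
^ (k - 1)` with `ρ δ ≥ 1` makes up for them. Here `k ≤ |S|`, because locations running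
simultaneously share no qubit (`card_hits_le`).

The sets `S` of size `n + 1` through a given qubit have total norm times `t₀` at most `α ^ (n + 1) /
n!`, each set arising from `n!` ordered tuples. Summing the exponential series gives `h_l(T) ≤ δ + m
α e^{α ρ}` (`majorant_le`). With `ρ = max 1 δ⁻¹` and `δ ↓ m α` this yields `‖E(I)‖ ≤ (m α (1 + e)) ^
|I|`, which is stronger than the claim because `(1 + e) / 2 ≤ e^{(e-1)/2}`. -/

namespace CorrelatedNoise

/-! ### Absolutely continuous functions and an energy estimate. -/

/-- `x` is absolutely continuous on `[0, T]` with almost everywhere derivative `k`. -/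
structure IsPrimitive {E : Type*} [NormedAddCommGroup E] [NormedSpace ℝ E] (T : ℝ)
    (x k : ℝ → E) : Prop where
  integrable : IntervalIntegrable k volume 0 T
  eq_add_integral : ∀ t ∈ Set.Icc 0 T, x t = x 0 + ∫ s in 0..t, k s

namespace IsPrimitive

section Vector

variable {E : Type*} [NormedAddCommGroup E] [NormedSpace ℝ E] {T : ℝ} {x k : ℝ → E}

lemma integrable_sub (h : IsPrimitive T x k) {s t : ℝ} (hs : s ∈ Set.Icc 0 T)
    (ht : t ∈ Set.Icc 0 T) : IntervalIntegrable k volume s t :=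
  h.integrable.mono_set (Set.uIcc_subset_uIcc (Set.Icc_subset_uIcc hs) (Set.Icc_subset_uIcc ht))

lemma sub_eq_integral (h : IsPrimitive T x k) {s t : ℝ} (hs : s ∈ Set.Icc 0 T)
    (ht : t ∈ Set.Icc 0 T) : x t - x s = ∫ u in s..t, k u := by
  have h0 : (0 : ℝ) ∈ Set.Icc 0 T := ⟨le_rfl, hs.1.trans hs.2⟩
  rw [h.eq_add_integral t ht, h.eq_add_integral s hs, add_sub_add_left_eq_sub,
    intervalIntegral.integral_interval_sub_left (h.integrable_sub h0 ht) (h.integrable_sub h0 hs)]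

lemma add_const (h : IsPrimitive T x k) (c : E) : IsPrimitive T (fun t => x t + c) k where
  integrable := h.integrable
  eq_add_integral t ht := by rw [h.eq_add_integral t ht]; abel

/-- Increments of `‖x‖` are dominated by those of `∫ ‖k‖`, which is absolutely continuous. -/
lemma absolutelyContinuous_norm (hT : 0 ≤ T) (h : IsPrimitive T x k) :
    AbsolutelyContinuousOnInterval (fun t => ‖x t‖) 0 T := by
  have hN := h.integrable.norm.absolutelyContinuousOnInterval_intervalIntegral
    (c := 0) Set.left_mem_uIcc
  have hp : IsPrimitive T (fun t => ∫ s in 0..t, ‖k s‖) (fun s => ‖k s‖) :=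
    ⟨h.integrable.norm, fun t _ => by simp⟩
  refine squeeze_zero' (Eventually.of_forall fun E => Finset.sum_nonneg fun _ _ => dist_nonneg)
    ?_ hN
  have hmem : ∀ᶠ E in AbsolutelyContinuousOnInterval.totalLengthFilter ⊓
      𝓟 (AbsolutelyContinuousOnInterval.disjWithin 0 T),
      E ∈ AbsolutelyContinuousOnInterval.disjWithin 0 T :=
    eventually_inf_principal.mpr (by simp)
  filter_upwards [hmem] with E hE
  refine Finset.sum_le_sum fun i hi => ?_
  obtain ⟨h1, h2⟩ := hE.1 i hi
  rw [Set.uIcc_of_le hT] at h1 h2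
  refine (dist_norm_norm_le _ _).trans ?_
  rw [h.sub_eq_integral h2 h1, Real.dist_eq, hp.sub_eq_integral h2 h1]
  exact intervalIntegral.norm_integral_le_abs_integral_norm

lemma ae_hasDerivAt [CompleteSpace E] (h : IsPrimitive T x k) :
    ∀ᵐ t, t ∈ Set.Ioo 0 T → HasDerivAt x (k t) t := by
  filter_upwards [h.integrable.ae_hasDerivAt_integral] with t ht hmem
  have h1 := ht (Set.Icc_subset_uIcc ⟨hmem.1.le, hmem.2.le⟩) 0 Set.left_mem_uIcc
  refine (h1.const_add (x 0)).congr_of_eventuallyEq ?_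
  filter_upwards [Ioo_mem_nhds hmem.1 hmem.2] with s hs
  exact h.eq_add_integral s ⟨hs.1.le, hs.2.le⟩

end Vector

section Real

variable {T : ℝ} {R r P p : ℝ → ℝ}

lemma absolutelyContinuous (hT : 0 ≤ T) (h : IsPrimitive T R r) :
    AbsolutelyContinuousOnInterval R 0 T := by
  have hN := h.integrable.absolutelyContinuousOnInterval_intervalIntegral
    (c := 0) Set.left_mem_uIcc
  have hp : IsPrimitive T (fun t => ∫ s in 0..t, r s) r := ⟨h.integrable, fun t _ => by simp⟩
  refine squeeze_zero' (Eventually.of_forall fun E => Finset.sum_nonneg fun _ _ => dist_nonneg)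
    ?_ hN
  have hmem : ∀ᶠ E in AbsolutelyContinuousOnInterval.totalLengthFilter ⊓
      𝓟 (AbsolutelyContinuousOnInterval.disjWithin 0 T),
      E ∈ AbsolutelyContinuousOnInterval.disjWithin 0 T :=
    eventually_inf_principal.mpr (by simp)
  filter_upwards [hmem] with E hE
  refine Finset.sum_le_sum fun i hi => ?_
  obtain ⟨h1, h2⟩ := hE.1 i hi
  rw [Set.uIcc_of_le hT] at h1 h2
  rw [Real.dist_eq, Real.dist_eq, hp.sub_eq_integral h2 h1, h.sub_eq_integral h2 h1]

lemma ae_of_Ioo {q : ℝ → Prop} (h : ∀ᵐ t, t ∈ Set.Ioo 0 T → q t) :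
    ∀ᵐ t, t ∈ Set.Icc 0 T → q t := by
  have h₁ : ∀ᵐ t : ℝ, t ≠ 0 := by simp [ae_iff, measure_singleton]
  have h₂ : ∀ᵐ t : ℝ, t ≠ T := by simp [ae_iff, measure_singleton]
  filter_upwards [h, h₁, h₂] with t ht h1 h2 hm
  exact ht ⟨lt_of_le_of_ne hm.1 (Ne.symm h1), lt_of_le_of_ne hm.2 h2⟩

/-- The fundamental theorem of calculus for absolutely continuous functions. It reduces product and
square rules to pointwise derivatives almost everywhere. -/
lemma of_absolutelyContinuous (hT : 0 ≤ T) (hR : AbsolutelyContinuousOnInterval R 0 T)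
    (hr : ∀ᵐ t, t ∈ Set.Ioo 0 T → HasDerivAt R (r t) t) : IsPrimitive T R r := by
  have hr' := ae_of_Ioo hr
  have hint : IntervalIntegrable r volume 0 T := by
    refine hR.intervalIntegrable_deriv.congr_ae ?_
    rw [Set.uIoc_of_le hT]
    refine (ae_restrict_iff' measurableSet_Ioc).2 ?_
    filter_upwards [hr'] with t ht hm
    exact (ht ⟨hm.1.le, hm.2⟩).deriv
  refine ⟨hint, fun t ht => ?_⟩
  have h1 := (hR.mono (c := 0) (d := t) (Set.uIcc_subset_uIcc Set.left_mem_uIcc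
    (Set.Icc_subset_uIcc ht))).integral_deriv_eq_sub
  have h2 : ∫ s in 0..t, deriv R s = ∫ s in 0..t, r s := by
    refine intervalIntegral.integral_congr_ae ?_
    rw [Set.uIoc_of_le ht.1]
    filter_upwards [hr'] with s hs hm
    exact (hs ⟨hm.1.le, hm.2.trans ht.2⟩).deriv
  rw [← h2, h1]
  ring

lemma mul (hT : 0 ≤ T) (hR : IsPrimitive T R r) (hP : IsPrimitive T P p) :
    IsPrimitive T (fun t => R t * P t) (fun t => r t * P t + R t * p t) := by
  refine of_absolutelyContinuous hT
    ((hR.absolutelyContinuous hT).mul (hP.absolutelyContinuous hT)) ?_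
  filter_upwards [hR.ae_hasDerivAt, hP.ae_hasDerivAt] with t h1 h2 hm
  exact (h1 hm).mul (h2 hm)

lemma finset_prod {ι : Type*} [DecidableEq ι] (hT : 0 ≤ T) (h g : ι → ℝ → ℝ)
    (hg : ∀ i, IsPrimitive T (h i) (g i)) (I : Finset ι) :
    IsPrimitive T (fun t => ∏ i ∈ I, h i t)
      (fun t => ∑ i ∈ I, g i t * ∏ j ∈ I.erase i, h j t) := by
  induction I using Finset.induction_on with
  | empty => exact ⟨by simp, fun t _ => by simp⟩
  | insert a I ha ih =>
    have hm := (hg a).mul hT ih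
    convert hm using 2 with t t
    · rw [Finset.prod_insert ha]
    · rw [Finset.sum_insert ha, Finset.erase_insert ha, Finset.mul_sum]
      congr 1
      refine Finset.sum_congr rfl fun i hi => ?_
      have hia : a ≠ i := fun h => ha (h ▸ hi)
      rw [Finset.erase_insert_of_ne hia, Finset.prod_insert (by simp [ha])]
      ring

/-- A primitive of a function that is nonpositive wherever the primitive is, and that starts
below zero, stays below zero. -/
lemma neg_of_deriv_nonpos (h : IsPrimitive T R r)
    (hcont : ContinuousOn R (Set.Icc 0 T)) (h0 : R 0 < 0)
    (hr : ∀ᵐ t, t ∈ Set.Icc 0 T → R t ≤ 0 → r t ≤ 0) : ∀ t ∈ Set.Icc 0 T, R t < 0 := by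
  by_contra! hcon
  obtain ⟨t₁, ht₁, hRt₁⟩ := hcon
  set Z := {t ∈ Set.Icc 0 T | 0 ≤ R t} with hZ
  have hclosed : IsClosed Z := by
    have : Z = Set.Icc 0 T ∩ R ⁻¹' Set.Ici 0 := by ext t; simp [hZ]
    rw [this]
    exact hcont.preimage_isClosed_of_isClosed isClosed_Icc isClosed_Ici
  have hbdd : BddBelow Z := ⟨0, fun t ht => ht.1.1⟩
  -- At the first time `τ` with `R τ ≥ 0`, `r ≤ 0` has held almost everywhere before, so `R τ ≤ R 0
  -- < 0`, a contradiction.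
  have hmem : sInf Z ∈ Z := hclosed.csInf_mem ⟨t₁, ht₁, hRt₁⟩ hbdd
  set τ := sInf Z
  have hlt : ∀ s ∈ Set.Ico 0 τ, R s < 0 := by
    intro s hs
    by_contra! hneg
    exact absurd (csInf_le hbdd ⟨⟨hs.1, hs.2.le.trans hmem.1.2⟩, hneg⟩) (not_le.2 hs.2)
  have hint : ∫ s in 0..τ, r s ≤ 0 := by
    rw [intervalIntegral.integral_of_le hmem.1.1]
    refine setIntegral_nonpos_of_ae_restrict ?_
    refine (ae_restrict_iff' measurableSet_Ioc).2 ?_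
    have h₂ : ∀ᵐ t : ℝ, t ≠ τ := by simp [ae_iff, measure_singleton]
    filter_upwards [hr, h₂] with s hs hne hm
    exact hs ⟨hm.1.le, hm.2.trans hmem.1.2⟩ (hlt s ⟨hm.1.le, lt_of_le_of_ne hm.2 hne⟩).le
  have := h.eq_add_integral τ hmem.1
  have := hmem.2
  linarith

end Real

/-- Energy estimate: if `Re ⟪x, x'⟫ ≤ ‖x‖ R'`, then `‖x‖ ≤ R` persists. -/
lemma norm_le {H : Type*} [NormedAddCommGroup H] [InnerProductSpace ℂ H] [CompleteSpace H]
    {T : ℝ} (hT : 0 ≤ T) {x k : ℝ → H} {R r : ℝ → ℝ} (hx : IsPrimitive T x k)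
    (hR : IsPrimitive T R r) (hr : ∀ s ∈ Set.Icc 0 T, 0 ≤ r s)
    (h : ∀ s ∈ Set.Icc 0 T, (inner ℂ (x s) (k s)).re ≤ ‖x s‖ * r s) (h0 : ‖x 0‖ ≤ R 0) :
    ∀ t ∈ Set.Icc 0 T, ‖x t‖ ≤ R t := by
  intro t ht
  -- The slack `η` makes the initial inequality strict and `R + η` positive.
  refine le_of_forall_pos_lt_add fun η hη => ?_
  have hRη := hR.add_const η
  have hR0 : ∀ s ∈ Set.Icc 0 T, 0 < R s + η := by
    intro s hs
    rw [hR.eq_add_integral s hs]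
    have : 0 ≤ ∫ u in 0..s, r u :=
      intervalIntegral.integral_nonneg hs.1 fun u hu => hr u ⟨hu.1, hu.2.trans hs.2⟩
    linarith [norm_nonneg (x 0)]
  have hacx := hx.absolutelyContinuous_norm hT
  have hacR := hRη.absolutelyContinuous hT
  have hac := (hacx.fun_mul hacx).fun_sub (hacR.fun_mul hacR)
  -- Squares are compared because the norm itself need not be differentiable where `x` vanishes.
  have hp : IsPrimitive T (fun s => ‖x s‖ * ‖x s‖ - (R s + η) * (R s + η))
      (fun s => 2 * (inner ℂ (x s) (k s)).re - (r s * (R s + η) + (R s + η) * r s)) := by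
    refine of_absolutelyContinuous hT hac ?_
    filter_upwards [hx.ae_hasDerivAt, hRη.ae_hasDerivAt] with s h1 h2 hm
    refine HasDerivAt.sub ?_ ((h2 hm).mul (h2 hm))
    have h3 := Complex.reCLM.hasFDerivAt.comp_hasDerivAt s ((h1 hm).inner ℂ (h1 hm))
    have h4 : (fun s => ‖x s‖ * ‖x s‖) = fun s => Complex.reCLM (inner ℂ (x s) (x s)) := by
      ext u
      exact (inner_self_eq_norm_mul_norm (𝕜 := ℂ) (x u)).symm
    rw [h4]
    refine HasDerivAt.congr_deriv h3 ?_
    rw [Complex.reCLM_apply, Complex.add_re, ← inner_conj_symm (k s) (x s), Complex.conj_re]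
    ring
  have hcont := hac.continuousOn
  rw [Set.uIcc_of_le hT] at hcont
  have hneg := hp.neg_of_deriv_nonpos hcont
    (by nlinarith [norm_nonneg (x 0)]) (ae_of_all _ fun s hs hle => ?_) t ht
  · nlinarith [hR0 t ht, norm_nonneg (x t)]
  · have h1 : ‖x s‖ ≤ R s + η := by nlinarith [hR0 s hs, norm_nonneg (x s)]
    nlinarith [h s hs, hr s hs, mul_le_mul_of_nonneg_right h1 (hr s hs)]

end IsPrimitive

/-! ### Single terms of the Dyson series. -/

/-- A finite family of bounded time-dependent operators, together with a relation that tells which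
members of the family hit which locations at which times. -/
structure Perturbation (σ L H : Type*) [NormedAddCommGroup H] [InnerProductSpace ℂ H] where
  op : σ → ℝ → H →L[ℂ] H
  hit : σ → ℝ → L → Prop
  bound : ℝ
  bound_nonneg : 0 ≤ bound
  -- Measurability is asked only after application to measurable vectors: with a merely strongly
  -- continuous `U₀`, the interaction picture need not be measurable for the operator norm.
  stronglyMeasurable_op : ∀ (S : σ) (Ω : Type) [MeasurableSpace Ω] (τ : Ω → ℝ) (φ : Ω → H),
    Measurable τ → StronglyMeasurable φ → StronglyMeasurable fun ω => op S (τ ω) (φ ω)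
  norm_op_le : ∀ S t, ‖op S t‖ ≤ bound
  measurableSet_hit : ∀ S l, MeasurableSet {t | hit S t l}

namespace Perturbation

variable {σ L H : Type*} [NormedAddCommGroup H] [InnerProductSpace ℂ H]
  (P : Perturbation σ L H)

open Classical in
/-- The locations in `I` that are hit by the insertion of `S` at time `t`. -/
noncomputable def hits (I : Finset L) (S : σ) (t : ℝ) : Finset L := I.filter (P.hit S t)

/-- The ordered insertion times in `[0, s)` for which every location in `I` is hit. -/
def times (I : Finset L) {n : ℕ} (w : Fin n → σ) (s : ℝ) : Set (Fin n → ℝ) :=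
  {t | StrictMono t ∧ (∀ j, t j ∈ Set.Ico 0 s) ∧ ∀ l ∈ I, ∃ j, P.hit (w j) (t j) l}

/-- The time-ordered product of the inserted operators, applied to `ψ`. -/
noncomputable def integrand {n : ℕ} (w : Fin n → σ) (t : Fin n → ℝ) (ψ : H) : H :=
  (List.ofFn fun j => P.op (w j) (t j)).reverse.prod ψ

/-- The term of the Dyson series up to time `s` with insertions `w`. -/
noncomputable def term (I : Finset L) {n : ℕ} (w : Fin n → σ) (s : ℝ) (ψ : H) : H :=
  ∫ t in P.times I w s, P.integrand w t ψ

lemma integrand_zero (w : Fin 0 → σ) (t : Fin 0 → ℝ) (ψ : H) : P.integrand w t ψ = ψ := by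
  simp [integrand]

lemma integrand_succ {n : ℕ} (w : Fin (n + 1) → σ) (t : Fin (n + 1) → ℝ) (ψ : H) :
    P.integrand w t ψ = P.op (w (Fin.last n)) (t (Fin.last n))
      (P.integrand (fun j => w j.castSucc) (fun j => t j.castSucc) ψ) := by
  simp only [integrand]
  rw [List.ofFn_succ', List.concat_eq_append, List.reverse_append]
  simp

lemma stronglyMeasurable_integrand {n : ℕ} (w : Fin n → σ) (ψ : H) :
    StronglyMeasurable fun t => P.integrand w t ψ := by
  induction n with
  | zero => simpa only [integrand_zero] using stronglyMeasurable_const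
  | succ n ih =>
    simp only [integrand_succ]
    refine P.stronglyMeasurable_op _ _ _ _ (measurable_pi_apply _) ?_
    exact (ih _).comp_measurable (measurable_pi_lambda _ fun j => measurable_pi_apply _)

lemma norm_integrand_le {n : ℕ} (w : Fin n → σ) (t : Fin n → ℝ) (ψ : H) :
    ‖P.integrand w t ψ‖ ≤ P.bound ^ n * ‖ψ‖ := by
  induction n with
  | zero => simp [integrand_zero]
  | succ n ih =>
    rw [integrand_succ, pow_succ', mul_assoc]
    exact (ContinuousLinearMap.le_opNorm _ _).trans
      (mul_le_mul (P.norm_op_le _ _) (ih _ _) (norm_nonneg _) P.bound_nonneg)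

lemma integrand_add {n : ℕ} (w : Fin n → σ) (t : Fin n → ℝ) (ψ φ : H) :
    P.integrand w t (ψ + φ) = P.integrand w t ψ + P.integrand w t φ := by
  simp [integrand]

lemma integrand_smul {n : ℕ} (w : Fin n → σ) (t : Fin n → ℝ) (c : ℂ) (ψ : H) :
    P.integrand w t (c • ψ) = c • P.integrand w t ψ := by
  simp [integrand]

/-- Once the last insertion is split off, its time is both the upper limit for the earlier times and
what determines the locations still to be hit. Hence joint measurability, with `J` depending on
time. -/
lemma measurableSet_times_prod [Fintype L] {n : ℕ} (w : Fin n → σ) (J : ℝ → Finset L)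
    (hJ : ∀ l, MeasurableSet {τ | l ∈ J τ}) :
    MeasurableSet {p : ℝ × (Fin n → ℝ) | p.2 ∈ P.times (J p.1) w p.1} := by
  have hj : ∀ j : Fin n, Measurable fun p : ℝ × (Fin n → ℝ) => p.2 j :=
    fun j => (measurable_pi_apply j).comp measurable_snd
  have : {p : ℝ × (Fin n → ℝ) | p.2 ∈ P.times (J p.1) w p.1} =
      (⋂ (i : Fin n) (j : Fin n) (_ : i < j), {p | p.2 i < p.2 j}) ∩
      ((⋂ j : Fin n, {p | 0 ≤ p.2 j} ∩ {p | p.2 j < p.1}) ∩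
        ⋂ l : L, {p | l ∈ J p.1}ᶜ ∪ ⋃ j : Fin n, {p | P.hit (w j) (p.2 j) l}) := by
    ext p
    simp only [times, StrictMono, Set.mem_Ico, Set.mem_ofPred_eq, Set.mem_inter_iff,
      Set.mem_iInter, Set.mem_union, Set.mem_compl_iff, Set.mem_iUnion, imp_iff_not_or]
  rw [this]
  refine MeasurableSet.inter ?_ (MeasurableSet.inter ?_ ?_)
  · exact .iInter fun i => .iInter fun j => .iInter fun _ => measurableSet_lt (hj i) (hj j)
  · exact .iInter fun j => (measurableSet_le measurable_const (hj j)).inter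
      (measurableSet_lt (hj j) measurable_fst)
  · exact .iInter fun l => (measurable_fst (hJ l)).compl.union
      (.iUnion fun j => hj j (P.measurableSet_hit (w j) l))

lemma measurableSet_times [Fintype L] (I : Finset L) {n : ℕ} (w : Fin n → σ) (s : ℝ) :
    MeasurableSet (P.times I w s) :=
  measurable_prodMk_left (x := s) (P.measurableSet_times_prod w (fun _ => I) fun l => by simp)

lemma times_subset (I : Finset L) {n : ℕ} (w : Fin n → σ) (s : ℝ) :
    P.times I w s ⊆ Set.pi Set.univ fun _ => Set.Ico 0 s := fun _ ht j _ => ht.2.1 j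

lemma volume_times_lt_top (I : Finset L) {n : ℕ} (w : Fin n → σ) (s : ℝ) :
    volume (P.times I w s) < ⊤ := by
  refine (measure_mono (P.times_subset I w s)).trans_lt ?_
  rw [volume_pi_pi]
  exact ENNReal.prod_lt_top fun j _ => by simp

lemma integrableOn_integrand (I : Finset L) {n : ℕ} (w : Fin n → σ) (s : ℝ) (ψ : H) :
    IntegrableOn (fun t => P.integrand w t ψ) (P.times I w s) :=
  Measure.integrableOn_of_bounded (P.volume_times_lt_top I w s).ne
    (P.stronglyMeasurable_integrand w ψ).aestronglyMeasurable
    (ae_of_all _ fun t => P.norm_integrand_le w t ψ)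

lemma mem_hits {I : Finset L} {S : σ} {t : ℝ} {l : L} :
    l ∈ P.hits I S t ↔ l ∈ I ∧ P.hit S t l := by
  simp [hits]

lemma hits_subset (I : Finset L) (S : σ) (t : ℝ) : P.hits I S t ⊆ I := by
  simp [hits]

lemma stronglyMeasurable_term [Fintype L] {n : ℕ} (w : Fin n → σ) (J : ℝ → Finset L)
    (hJ : ∀ l, MeasurableSet {τ | l ∈ J τ}) (ψ : H) :
    StronglyMeasurable fun τ => P.term (J τ) w τ ψ := by
  have h : StronglyMeasurable (fun p : ℝ × (Fin n → ℝ) =>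
      Set.indicator {p : ℝ × (Fin n → ℝ) | p.2 ∈ P.times (J p.1) w p.1}
        (fun p => P.integrand w p.2 ψ) p) :=
    ((P.stronglyMeasurable_integrand w ψ).comp_measurable measurable_snd).indicator
      (P.measurableSet_times_prod w J hJ)
  have h2 := h.integral_prod_right' (ν := (volume : Measure (Fin n → ℝ)))
  convert h2 using 2 with τ
  unfold term
  rw [← integral_indicator (P.measurableSet_times _ w τ)]
  rfl

lemma term_add (I : Finset L) {n : ℕ} (w : Fin n → σ) (s : ℝ) (ψ φ : H) :
    P.term I w s (ψ + φ) = P.term I w s ψ + P.term I w s φ := by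
  unfold term
  simp only [integrand_add]
  exact integral_add (P.integrableOn_integrand I w s ψ) (P.integrableOn_integrand I w s φ)

lemma term_smul (I : Finset L) {n : ℕ} (w : Fin n → σ) (s : ℝ) (c : ℂ) (ψ : H) :
    P.term I w s (c • ψ) = c • P.term I w s ψ := by
  unfold term
  simp only [integrand_smul]
  exact integral_smul _ _

variable [DecidableEq L]

/-- The half-open interval fits strict ordering: the earlier times lie in `[0, τ)` exactly when they
precede the last time `τ`. -/
lemma mem_times_succ (I : Finset L) {n : ℕ} (w : Fin (n + 1) → σ) (s : ℝ)
    (t : Fin (n + 1) → ℝ) :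
    t ∈ P.times I w s ↔ t (Fin.last n) ∈ Set.Ico 0 s ∧
      (fun j : Fin n => t j.castSucc) ∈
        P.times (I \ P.hits I (w (Fin.last n)) (t (Fin.last n))) (fun j => w j.castSucc)
          (t (Fin.last n)) := by
  constructor
  · rintro ⟨h1, h2, h3⟩
    refine ⟨h2 _, fun i j hij => h1 (Fin.castSucc_lt_castSucc_iff.2 hij),
      fun j => ⟨(h2 _).1, h1 (Fin.castSucc_lt_last j)⟩, fun l hl => ?_⟩
    rw [Finset.mem_sdiff, mem_hits] at hl
    obtain ⟨j, hj⟩ := h3 l hl.1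
    induction j using Fin.lastCases with
    | last => exact absurd ⟨hl.1, hj⟩ hl.2
    | cast j => exact ⟨j, hj⟩
  · rintro ⟨h0, h1, h2, h3⟩
    refine ⟨fun i j hij => ?_, fun j => ?_, fun l hl => ?_⟩
    · induction j using Fin.lastCases with
      | last =>
        induction i using Fin.lastCases with
        | last => exact absurd hij (lt_irrefl _)
        | cast i => exact (h2 i).2
      | cast j =>
        induction i using Fin.lastCases with
        | last => exact absurd hij (not_lt.2 (Fin.le_last _))
        | cast i => exact h1 (Fin.castSucc_lt_castSucc_iff.1 hij)
    · induction j using Fin.lastCases with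
      | last => exact h0
      | cast j => exact ⟨(h2 j).1, (h2 j).2.trans h0.2⟩
    · by_cases hh : P.hit (w (Fin.last n)) (t (Fin.last n)) l
      · exact ⟨_, hh⟩
      · obtain ⟨j, hj⟩ := h3 l (by simp [mem_hits, hl, hh])
        exact ⟨_, hj⟩

lemma measurableSet_mem_sdiff_hits (I : Finset L) (S : σ) (l : L) :
    MeasurableSet {τ | l ∈ I \ P.hits I S τ} := by
  by_cases hl : l ∈ I
  · have : {τ | l ∈ I \ P.hits I S τ} = {τ | P.hit S τ l}ᶜ := by
      ext τ; simp [mem_hits, hl]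
    rw [this]
    exact (P.measurableSet_hit S l).compl
  · simp [hl]

variable [CompleteSpace H]

lemma term_zero (I : Finset L) (w : Fin 0 → σ) (s : ℝ) (ψ : H) :
    P.term I w s ψ = if I = ∅ then ψ else 0 := by
  have h : P.times I w s = if I = ∅ then Set.univ else ∅ := by
    split_ifs with hI
    · subst hI
      ext t
      simp [times, Subsingleton.strictMono]
    · obtain ⟨l, hl⟩ := Finset.nonempty_iff_ne_empty.2 hI
      ext t
      simp only [times, Set.mem_ofPred_eq, Set.mem_empty_iff_false, iff_false]
      rintro ⟨-, -, h⟩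
      exact (h l hl).choose.elim0
  unfold term
  simp only [integrand_zero, h]
  split_ifs
  · rw [setIntegral_univ, integral_const]
    simp [Measure.real, volume_pi]
  · simp

variable [Fintype L]

/-- Fubini in the last coordinate; the last operator is bounded and so comes out of the inner
integral. -/
lemma term_succ (I : Finset L) {n : ℕ} (w : Fin (n + 1) → σ) {s : ℝ} (hs : 0 ≤ s) (ψ : H) :
    P.term I w s ψ = ∫ τ in 0..s, P.op (w (Fin.last n)) τ
      (P.term (I \ P.hits I (w (Fin.last n)) τ) (fun j => w j.castSucc) τ ψ) := by
  set S := w (Fin.last n)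
  set w' : Fin n → σ := fun j => w j.castSucc
  let e := MeasurableEquiv.piFinSuccAbove (fun _ : Fin (n + 1) => ℝ) (Fin.last n)
  have he : MeasurePreserving e.symm :=
    (volume_preserving_piFinSuccAbove (fun _ : Fin (n + 1) => ℝ) (Fin.last n)).symm _
  have hlast : ∀ p, e.symm p (Fin.last n) = p.1 := fun p => by
    change Fin.insertNth (α := fun _ => ℝ) (Fin.last n) p.1 p.2 (Fin.last n) = p.1
    simp
  have hcast : ∀ p, (fun j : Fin n => e.symm p j.castSucc) = p.2 := fun p => by
    ext j
    change Fin.insertNth (α := fun _ => ℝ) (Fin.last n) p.1 p.2 j.castSucc = p.2 j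
    rw [← Fin.succAbove_last, Fin.insertNth_apply_succAbove]
  have hI := (integrable_indicator_iff (P.measurableSet_times I w s)).2
    (P.integrableOn_integrand I w s ψ)
  have hI' := (he.integrable_comp_emb e.symm.measurableEmbedding).2 hI
  have hval : ∀ p : ℝ × (Fin n → ℝ), (P.times I w s).indicator (fun t => P.integrand w t ψ)
      (e.symm p) = (Set.Ico 0 s).indicator (fun τ => P.op S τ
        ((P.times (I \ P.hits I S τ) w' τ).indicator (fun t => P.integrand w' t ψ) p.2)) p.1 := by
    intro p
    have hm := P.mem_times_succ I w s (e.symm p)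
    rw [hlast, hcast] at hm
    by_cases h1 : p.1 ∈ Set.Ico 0 s
    · by_cases h2 : p.2 ∈ P.times (I \ P.hits I S p.1) w' p.1
      · rw [Set.indicator_of_mem (hm.2 ⟨h1, h2⟩), Set.indicator_of_mem h1,
          Set.indicator_of_mem h2, integrand_succ, hlast, hcast]
      · rw [Set.indicator_of_notMem (fun h => h2 (hm.1 h).2), Set.indicator_of_mem h1,
          Set.indicator_of_notMem h2, map_zero]
    · rw [Set.indicator_of_notMem (fun h => h1 (hm.1 h).1), Set.indicator_of_notMem h1]
  unfold term
  rw [← integral_indicator (P.measurableSet_times I w s), ← he.integral_comp',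
    Measure.volume_eq_prod, integral_prod _ (by exact hI'), intervalIntegral.integral_of_le hs,
    ← integral_Ico_eq_integral_Ioc, ← integral_indicator measurableSet_Ico]
  refine integral_congr_ae (ae_of_all _ fun τ => ?_)
  simp only [hval]
  by_cases h1 : τ ∈ Set.Ico 0 s
  · simp only [Set.indicator_of_mem h1]
    rw [← integral_indicator (P.measurableSet_times _ w' τ), ContinuousLinearMap.integral_comp_comm]
    exact (integrable_indicator_iff (P.measurableSet_times _ w' τ)).2
      (P.integrableOn_integrand _ w' τ ψ)
  · simp [Set.indicator_of_notMem h1]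

/-- The factor `s ^ n / n!` is the volume of the simplex of ordered times. -/
lemma norm_term_le (I : Finset L) {n : ℕ} (w : Fin n → σ) {s : ℝ} (hs : 0 ≤ s) (ψ : H) :
    ‖P.term I w s ψ‖ ≤ P.bound ^ n * s ^ n / n.factorial * ‖ψ‖ := by
  induction n generalizing I s with
  | zero =>
    rw [term_zero]
    split_ifs <;> simp
  | succ n ih =>
    rw [P.term_succ I w hs]
    have h1 : ‖∫ τ in 0..s, P.op (w (Fin.last n)) τ
        (P.term (I \ P.hits I (w (Fin.last n)) τ) (fun j => w j.castSucc) τ ψ)‖ ≤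
        ∫ τ in 0..s, P.bound * (P.bound ^ n * τ ^ n / n.factorial * ‖ψ‖) := by
      refine intervalIntegral.norm_integral_le_of_norm_le hs (ae_of_all _ fun τ hτ => ?_)
        (Continuous.intervalIntegrable (by fun_prop) _ _)
      exact (ContinuousLinearMap.le_opNorm _ _).trans
        (mul_le_mul (P.norm_op_le _ _) (ih _ _ hτ.1.le) (norm_nonneg _) P.bound_nonneg)
    refine h1.trans (le_of_eq ?_)
    have h2 : ∀ τ : ℝ, P.bound * (P.bound ^ n * τ ^ n / n.factorial * ‖ψ‖) =
        (P.bound ^ (n + 1) / n.factorial * ‖ψ‖) * τ ^ n := fun τ => by ring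
    simp only [h2]
    rw [intervalIntegral.integral_const_mul, integral_pow, Nat.factorial_succ]
    push_cast
    have : (n.factorial : ℝ) ≠ 0 := by positivity
    field_simp
    simp

lemma intervalIntegrable_op_term (I : Finset L) {n : ℕ} (w : Fin n → σ) (S : σ) {s : ℝ}
    (hs : 0 ≤ s) (ψ : H) :
    IntervalIntegrable (fun τ => P.op S τ (P.term (I \ P.hits I S τ) w τ ψ)) volume 0 s := by
  have hb : IntervalIntegrable
      (fun τ : ℝ => P.bound * (P.bound ^ n * τ ^ n / n.factorial * ‖ψ‖)) volume 0 s :=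
    Continuous.intervalIntegrable (by fun_prop) _ _
  refine hb.mono_fun' (P.stronglyMeasurable_op S ℝ id _ measurable_id
    (P.stronglyMeasurable_term w _
      (P.measurableSet_mem_sdiff_hits I S) ψ)).aestronglyMeasurable ?_
  rw [Set.uIoc_of_le hs]
  refine (ae_restrict_iff' measurableSet_Ioc).2 (ae_of_all _ fun τ hτ => ?_)
  exact (ContinuousLinearMap.le_opNorm _ _).trans
    (mul_le_mul (P.norm_op_le _ _) (P.norm_term_le _ _ hτ.1.le ψ) (norm_nonneg _) P.bound_nonneg)

end Perturbation

/-! ### Summation of the Dyson series and its integral equation. -/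

namespace Perturbation

variable {σ L H : Type*} [NormedAddCommGroup H] [InnerProductSpace ℂ H]
  (P : Perturbation σ L H) [Fintype σ]

/-- The sum of the terms of order `n` of the Dyson series. -/
noncomputable def layer (I : Finset L) (n : ℕ) (s : ℝ) (ψ : H) : H :=
  ∑ w : Fin n → σ, P.term I w s ψ

/-- The sum of the terms of the Dyson series for which every location in `I` is hit. -/
noncomputable def total (I : Finset L) (s : ℝ) (ψ : H) : H := ∑' n, P.layer I n s ψ

lemma stronglyMeasurable_layer [Fintype L] (n : ℕ) (J : ℝ → Finset L)
    (hJ : ∀ l, MeasurableSet {τ | l ∈ J τ}) (ψ : H) :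
    StronglyMeasurable fun τ => P.layer (J τ) n τ ψ :=
  Finset.stronglyMeasurable_fun_sum _ fun w _ => P.stronglyMeasurable_term w J hJ ψ

variable [DecidableEq L]

lemma stronglyMeasurable_op_layer [Fintype L] (I : Finset L) (n : ℕ) (S : σ) (ψ : H) :
    StronglyMeasurable fun τ => P.op S τ (P.layer (I \ P.hits I S τ) n τ ψ) :=
  P.stronglyMeasurable_op S ℝ id _ measurable_id
    (P.stronglyMeasurable_layer n _ (P.measurableSet_mem_sdiff_hits I S) ψ)

variable [CompleteSpace H]

lemma layer_zero (I : Finset L) (s : ℝ) (ψ : H) :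
    P.layer I 0 s ψ = if I = ∅ then ψ else 0 := by
  simp [layer, term_zero]

variable [Fintype L]

lemma norm_layer_le (I : Finset L) (n : ℕ) {s : ℝ} (hs : 0 ≤ s) (ψ : H) :
    ‖P.layer I n s ψ‖ ≤ (Fintype.card σ * P.bound * s) ^ n / n.factorial * ‖ψ‖ := by
  refine (norm_sum_le _ _).trans ((Finset.sum_le_sum fun w _ => P.norm_term_le I w hs ψ).trans ?_)
  rw [Finset.sum_const, Finset.card_univ, Fintype.card_fun, Fintype.card_fin, nsmul_eq_mul]
  push_cast
  refine le_of_eq ?_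
  ring

lemma summable_layer_bound (a b : ℝ) : Summable fun n : ℕ => a ^ n / n.factorial * b :=
  (Real.summable_pow_div_factorial a).mul_right b

lemma hasSum_layer (I : Finset L) {s : ℝ} (hs : 0 ≤ s) (ψ : H) :
    HasSum (fun n => P.layer I n s ψ) (P.total I s ψ) :=
  (Summable.of_norm_bounded (summable_layer_bound _ _)
    fun n => P.norm_layer_le I n hs ψ).hasSum

/-- A crude bound, growing with the number of coupling terms; it serves to make the sum a bounded
operator. -/
lemma norm_total_le (I : Finset L) {s : ℝ} (hs : 0 ≤ s) (ψ : H) :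
    ‖P.total I s ψ‖ ≤ Real.exp (Fintype.card σ * P.bound * s) * ‖ψ‖ := by
  refine tsum_of_norm_bounded ?_ fun n => P.norm_layer_le I n hs ψ
  rw [Real.exp_eq_exp_ℝ]
  exact (NormedSpace.expSeries_div_hasSum_exp (𝔸 := ℝ) _).mul_right _

/-- Absolute convergence over all words permits regrouping by order, and gives the unconditional sum
required by `IsFaultSum`. -/
lemma hasSum_term (I : Finset L) {s : ℝ} (hs : 0 ≤ s) (ψ : H) :
    HasSum (fun w : Σ n : ℕ, Fin n → σ => P.term I w.2 s ψ) (P.total I s ψ) := by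
  have hsum : Summable fun w : Σ n : ℕ, Fin n → σ =>
      P.bound ^ w.1 * s ^ w.1 / w.1.factorial * ‖ψ‖ := by
    refine (summable_sigma_of_nonneg fun w => ?_).2 ⟨fun n => Summable.of_finite, ?_⟩
    · have := P.bound_nonneg
      positivity
    · refine (summable_layer_bound (Fintype.card σ * P.bound * s) ‖ψ‖).congr fun n => ?_
      simp only [tsum_fintype]
      rw [Finset.sum_const, Finset.card_univ, Fintype.card_fun, Fintype.card_fin,
        nsmul_eq_mul]
      push_cast
      ring
  have hterm : Summable fun w : Σ n : ℕ, Fin n → σ => P.term I w.2 s ψ :=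
    Summable.of_norm_bounded hsum fun w => P.norm_term_le I w.2 hs ψ
  have h1 := hterm.hasSum.sigma fun n => hasSum_fintype _
  rw [show P.total I s ψ = ∑' w : Σ n : ℕ, Fin n → σ, P.term I w.2 s ψ from
    (P.hasSum_layer I hs ψ).unique h1]
  exact hterm.hasSum

lemma norm_op_layer_le (I : Finset L) (n : ℕ) (S : σ) {τ T : ℝ} (h0 : 0 ≤ τ) (hT : τ ≤ T)
    (ψ : H) : ‖P.op S τ (P.layer (I \ P.hits I S τ) n τ ψ)‖ ≤
      P.bound * ((Fintype.card σ * P.bound * T) ^ n / n.factorial * ‖ψ‖) := by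
  refine (ContinuousLinearMap.le_opNorm _ _).trans
    (mul_le_mul (P.norm_op_le _ _) ((P.norm_layer_le _ _ h0 ψ).trans ?_) (norm_nonneg _)
      P.bound_nonneg)
  have := P.bound_nonneg
  gcongr

lemma layer_succ (I : Finset L) (n : ℕ) {s : ℝ} (hs : 0 ≤ s) (ψ : H) :
    P.layer I (n + 1) s ψ =
      ∫ τ in 0..s, ∑ S, P.op S τ (P.layer (I \ P.hits I S τ) n τ ψ) := by
  have h1 : ∀ τ, ∑ S, P.op S τ (P.layer (I \ P.hits I S τ) n τ ψ) =
      ∑ p : σ × (Fin n → σ), P.op p.1 τ (P.term (I \ P.hits I p.1 τ) p.2 τ ψ) := fun τ => by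
    rw [Fintype.sum_prod_type]
    simp only [layer, map_sum]
  simp only [h1]
  rw [intervalIntegral.integral_finsetSum
    fun p _ => P.intervalIntegrable_op_term I p.2 p.1 hs ψ]
  unfold layer
  rw [← (Fin.insertNthEquiv (fun _ => σ) (Fin.last n)).sum_comp]
  refine Finset.sum_congr rfl fun p _ => ?_
  rw [P.term_succ I _ hs]
  simp

/-- The integral equation satisfied by the Dyson series, obtained by splitting off the last
insertion. -/
lemma isPrimitive_total (I : Finset L) {T : ℝ} (hT : 0 ≤ T) (ψ : H) :
    IsPrimitive T (fun s => P.total I s ψ)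
      (fun τ => ∑ S, P.op S τ (P.total (I \ P.hits I S τ) τ ψ)) := by
  have hsum : ∀ τ, 0 ≤ τ → HasSum
      (fun n => ∑ S, P.op S τ (P.layer (I \ P.hits I S τ) n τ ψ))
      (∑ S, P.op S τ (P.total (I \ P.hits I S τ) τ ψ)) := fun τ hτ =>
    hasSum_sum fun S _ => (P.op S τ).hasSum (P.hasSum_layer _ hτ ψ)
  have hmeas : ∀ n, StronglyMeasurable
      fun τ => ∑ S, P.op S τ (P.layer (I \ P.hits I S τ) n τ ψ) := fun n =>
    Finset.stronglyMeasurable_fun_sum _ fun S _ => P.stronglyMeasurable_op_layer I n S ψ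
  have hbound : ∀ n τ, τ ∈ Set.Ioc 0 T →
      ‖∑ S, P.op S τ (P.layer (I \ P.hits I S τ) n τ ψ)‖ ≤
        ∑ _S : σ, P.bound * ((Fintype.card σ * P.bound * T) ^ n / n.factorial * ‖ψ‖) :=
    fun n τ hτ => (norm_sum_le _ _).trans
      (Finset.sum_le_sum fun S _ => P.norm_op_layer_le I n S hτ.1.le hτ.2 ψ)
  have hbsum : Summable fun n : ℕ =>
      ∑ _S : σ, P.bound * ((Fintype.card σ * P.bound * T) ^ n / n.factorial * ‖ψ‖) :=
    summable_sum fun S _ => (summable_layer_bound _ _).mul_left _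
  -- Dominated convergence lets the sum over orders pass through the integral in `layer_succ`.
  have hint : ∀ s ∈ Set.Icc 0 T, HasSum (fun n => P.layer I (n + 1) s ψ)
      (∫ τ in 0..s, ∑ S, P.op S τ (P.total (I \ P.hits I S τ) τ ψ)) := by
    intro s hs
    simp only [fun n => P.layer_succ I n hs.1 ψ]
    refine intervalIntegral.hasSum_integral_of_dominated_convergence
      (fun n _ => ∑ _S : σ, P.bound * ((Fintype.card σ * P.bound * T) ^ n / n.factorial * ‖ψ‖))
      (fun n => (hmeas n).aestronglyMeasurable) (fun n => ae_of_all _ fun τ hτ => ?_)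
      (ae_of_all _ fun _ _ => hbsum) intervalIntegrable_const (ae_of_all _ fun τ hτ => ?_)
    · rw [Set.uIoc_of_le hs.1] at hτ
      exact hbound n τ ⟨hτ.1, hτ.2.trans hs.2⟩
    · rw [Set.uIoc_of_le hs.1] at hτ
      exact hsum τ hτ.1.le
  have htot : ∀ s ∈ Set.Icc 0 T, P.total I s ψ = (if I = ∅ then ψ else 0) +
      ∫ τ in 0..s, ∑ S, P.op S τ (P.total (I \ P.hits I S τ) τ ψ) := by
    intro s hs
    rw [← (hint s hs).tsum_eq, ← P.layer_zero I s ψ]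
    exact (P.hasSum_layer I hs.1 ψ).summable.tsum_eq_zero_add
  refine ⟨?_, fun t ht => ?_⟩
  · refine (intervalIntegrable_const (c := ∑' n : ℕ, ∑ _S : σ,
      P.bound * ((Fintype.card σ * P.bound * T) ^ n / n.factorial * ‖ψ‖))).mono_fun' ?_ ?_
    · refine aestronglyMeasurable_of_tendsto_ae atTop (fun n =>
        (Finset.stronglyMeasurable_fun_sum (Finset.range n) fun m _ =>
          hmeas m).aestronglyMeasurable) ?_
      rw [Set.uIoc_of_le hT]
      exact (ae_restrict_iff' measurableSet_Ioc).2
        (ae_of_all _ fun τ hτ => (hsum τ hτ.1.le).tendsto_sum_nat)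
    · rw [Set.uIoc_of_le hT]
      refine (ae_restrict_iff' measurableSet_Ioc).2 (ae_of_all _ fun τ hτ => ?_)
      simp only [← (hsum τ hτ.1.le).tsum_eq]
      exact tsum_of_norm_bounded hbsum.hasSum fun n => hbound n τ hτ
  · rw [htot t ht, htot 0 ⟨le_rfl, hT⟩, intervalIntegral.integral_same, add_zero]

lemma total_zero (I : Finset L) (ψ : H) :
    P.total I 0 ψ = if I = ∅ then ψ else 0 := by
  have h : ∀ n, P.layer I (n + 1) 0 ψ = 0 := fun n => by
    rw [P.layer_succ I n le_rfl, intervalIntegral.integral_same]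
  unfold total
  rw [(P.hasSum_layer I le_rfl ψ).summable.tsum_eq_zero_add, layer_zero]
  simp [h]

/-- The sum of the Dyson series, as a bounded operator. -/
noncomputable def totalCLM (I : Finset L) {s : ℝ} (hs : 0 ≤ s) : H →L[ℂ] H :=
  LinearMap.mkContinuous
    { toFun := P.total I s
      map_add' := fun ψ φ => by
        refine (P.hasSum_term I hs _).unique ?_
        simpa only [term_add] using (P.hasSum_term I hs ψ).add (P.hasSum_term I hs φ)
      map_smul' := fun c ψ => by
        refine (P.hasSum_term I hs _).unique ?_
        simpa only [term_smul, RingHom.id_apply] using (P.hasSum_term I hs ψ).const_smul c }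
    (Real.exp (Fintype.card σ * P.bound * s)) (fun ψ => P.norm_total_le I hs ψ)

lemma totalCLM_apply (I : Finset L) {s : ℝ} (hs : 0 ≤ s) (ψ : H) :
    P.totalCLM I hs ψ = P.total I s ψ := rfl

end Perturbation

/-! ### Domination of the faults by a product over locations. -/

lemma IsPrimitive.mul_const {T : ℝ} {R r : ℝ → ℝ} (h : IsPrimitive T R r) (c : ℝ) :
    IsPrimitive T (fun t => R t * c) (fun t => r t * c) where
  integrable := h.integrable.mul_const c
  eq_add_integral t ht := by
    rw [h.eq_add_integral t ht, intervalIntegral.integral_mul_const, add_mul]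

namespace Perturbation

variable {σ L H : Type*} [NormedAddCommGroup H] [InnerProductSpace ℂ H]
  (P : Perturbation σ L H)

variable {P} in
-- The right-hand product has extra factors for the hit locations other than `l`. There are at most
-- `wt S` of them, each at least `δ`, so together with `ρ ^ wt S` they contribute at least `1`.
lemma prod_sdiff_hits_le [DecidableEq L] {δ ρ : ℝ} {wt : σ → ℕ} (hδ : 0 < δ) (hρ : 1 ≤ ρ) (hρδ : 1 ≤ ρ * δ) {h : L → ℝ}
    (hh : ∀ l, δ ≤ h l) {I : Finset L} {S : σ} {t : ℝ} (hcard : (P.hits I S t).card ≤ wt S + 1)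
    {l : L} (hl : l ∈ P.hits I S t) :
    ∏ j ∈ I \ P.hits I S t, h j ≤ ρ ^ wt S * ∏ j ∈ I.erase l, h j := by
  have hdisj : Disjoint (I \ P.hits I S t) ((P.hits I S t).erase l) :=
    Finset.sdiff_disjoint.mono_right (Finset.erase_subset _ _)
  have hunion : I.erase l = (I \ P.hits I S t) ∪ (P.hits I S t).erase l := by
    ext j
    have hlI := P.hits_subset I S t hl
    have hjI : j ∈ P.hits I S t → j ∈ I := fun h => P.hits_subset I S t h
    by_cases hj : j = l
    · subst hj; simp [hl]
    · simp only [Finset.mem_erase, Finset.mem_union, Finset.mem_sdiff]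
      tauto
  have hpos : ∀ j, 0 < h j := fun j => hδ.trans_le (hh j)
  rw [hunion, Finset.prod_union hdisj]
  have h1 : 1 ≤ ρ ^ wt S * ∏ j ∈ (P.hits I S t).erase l, h j := by
    calc (1 : ℝ) ≤ (ρ * δ) ^ ((P.hits I S t).erase l).card := one_le_pow₀ hρδ
      _ = ρ ^ ((P.hits I S t).erase l).card * ∏ _j ∈ (P.hits I S t).erase l, δ := by
        rw [mul_pow, Finset.prod_const]
      _ ≤ _ := by
        refine mul_le_mul (pow_le_pow_right₀ hρ ?_)
          (Finset.prod_le_prod (fun _ _ => hδ.le) fun j _ => hh j)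
          (Finset.prod_nonneg fun _ _ => hδ.le) (by positivity)
        rw [Finset.card_erase_of_mem hl]
        omega
  have h2 : 0 ≤ ∏ j ∈ I \ P.hits I S t, h j := Finset.prod_nonneg fun j _ => (hpos j).le
  nlinarith

variable [Fintype σ]

open Classical in
/-- The rate at which location `l` is hit, an insertion of `S` being counted with weight
`ρ ^ wt S`. -/
noncomputable def rate (ρ : ℝ) (wt : σ → ℕ) (l : L) (s : ℝ) : ℝ :=
  ∑ S, if P.hit S s l then ‖P.op S s‖ * ρ ^ wt S else 0

/-- The solution of the differential inequality that dominates the faults at location `l`. -/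
noncomputable def majorant (δ ρ : ℝ) (wt : σ → ℕ) (l : L) (t : ℝ) : ℝ :=
  δ + ∫ s in 0..t, P.rate ρ wt l s

variable {P} {δ ρ : ℝ} {wt : σ → ℕ}

lemma rate_nonneg (hρ : 0 ≤ ρ) (l : L) (s : ℝ) : 0 ≤ P.rate ρ wt l s := by
  refine Finset.sum_nonneg fun S _ => ?_
  split_ifs
  · positivity
  · exact le_rfl

lemma intervalIntegrable_rate (hρ : 0 ≤ ρ) (hmeas : ∀ S, Measurable fun t => ‖P.op S t‖) (l : L)
    (a b : ℝ) : IntervalIntegrable (P.rate ρ wt l) volume a b := by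
  refine (intervalIntegrable_const (c := ∑ S, P.bound * ρ ^ wt S)).mono_fun' ?_ ?_
  · refine Measurable.aestronglyMeasurable ?_
    unfold rate
    exact Finset.measurable_fun_sum _ fun S _ => Measurable.ite (P.measurableSet_hit S l)
      ((hmeas S).mul_const _) measurable_const
  · refine ae_of_all _ fun s => ?_
    simp only
    rw [Real.norm_of_nonneg (rate_nonneg hρ l s)]
    refine Finset.sum_le_sum fun S _ => ?_
    have := P.bound_nonneg
    split_ifs
    · have := P.norm_op_le S s
      gcongr
    · positivity

lemma isPrimitive_majorant (hρ : 0 ≤ ρ) (hmeas : ∀ S, Measurable fun t => ‖P.op S t‖) (T : ℝ)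
    (l : L) : IsPrimitive T (P.majorant δ ρ wt l) (P.rate ρ wt l) where
  integrable := intervalIntegrable_rate hρ hmeas l 0 T
  eq_add_integral t _ := by simp [majorant]

lemma le_majorant (hρ : 0 ≤ ρ) (l : L) {t : ℝ} (ht : 0 ≤ t) : δ ≤ P.majorant δ ρ wt l t :=
  le_add_of_nonneg_right (intervalIntegral.integral_nonneg ht fun s _ => rate_nonneg hρ l s)

variable [DecidableEq L]

variable [Fintype L] [CompleteSpace H]

/-- The faults of a perturbation by skew-adjoint operators are dominated by the product of the
majorants of the locations. -/
theorem norm_total_le_prod_majorant (hδ : 0 < δ) (hρ : 1 ≤ ρ) (hρδ : 1 ≤ ρ * δ)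
    (hcard : ∀ I S t, (P.hits I S t).card ≤ wt S + 1)
    (hskew : ∀ S t ψ, (inner ℂ ψ (P.op S t ψ)).re = 0)
    (hmeas : ∀ S, Measurable fun t => ‖P.op S t‖) {T : ℝ} (hT : 0 ≤ T) (ψ : H) (I : Finset L) :
    ∀ t ∈ Set.Icc 0 T, ‖P.total I t ψ‖ ≤ (∏ l ∈ I, P.majorant δ ρ wt l t) * ‖ψ‖ := by
  have hρ0 : 0 ≤ ρ := zero_le_one.trans hρ
  induction I using Finset.strongInduction with
  | H I ih =>
    have hmaj : ∀ s ∈ Set.Icc 0 T, ∀ l, δ ≤ P.majorant δ ρ wt l s :=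
      fun s hs l => le_majorant hρ0 l hs.1
    have hmaj0 : ∀ s ∈ Set.Icc 0 T, ∀ l, 0 ≤ P.majorant δ ρ wt l s :=
      fun s hs l => hδ.le.trans (hmaj s hs l)
    have hR := (IsPrimitive.finset_prod hT (P.majorant δ ρ wt) (P.rate ρ wt)
      (isPrimitive_majorant hρ0 hmeas T) I).mul_const ‖ψ‖
    refine (P.isPrimitive_total I hT ψ).norm_le hT hR (fun s hs => ?_) (fun s hs => ?_) ?_
    · exact mul_nonneg (Finset.sum_nonneg fun l _ => mul_nonneg (rate_nonneg hρ0 l s)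
        (Finset.prod_nonneg fun j _ => hmaj0 s hs j)) (norm_nonneg _)
    -- Exchanging the sums sorts the product rule by insertion `S`, so that the two sides can be
    -- compared one `S` at a time.
    · have hr : (∑ l ∈ I, P.rate ρ wt l s * ∏ j ∈ I.erase l, P.majorant δ ρ wt j s) * ‖ψ‖ =
          ∑ S, (∑ l ∈ P.hits I S s, ‖P.op S s‖ * ρ ^ wt S *
            ∏ j ∈ I.erase l, P.majorant δ ρ wt j s) * ‖ψ‖ := by
        simp only [rate, hits, Finset.sum_filter, Finset.sum_mul, ite_mul, zero_mul]
        exact Finset.sum_comm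
      rw [hr, inner_sum, Complex.re_sum, Finset.mul_sum]
      refine Finset.sum_le_sum fun S _ => ?_
      obtain hempty | ⟨l, hl⟩ := (P.hits I S s).eq_empty_or_nonempty
      -- An insertion that hits nothing acts on `x_I` itself, and skew-adjointness removes it.
      · rw [hempty, Finset.sdiff_empty, hskew]
        simp
      · have hss : I \ P.hits I S s ⊂ I :=
          Finset.sdiff_ssubset (P.hits_subset I S s) ⟨l, hl⟩
        have h1 := prod_sdiff_hits_le hδ hρ hρδ (hmaj s hs) (hcard I S s) hl
        refine (Complex.re_le_norm _).trans ((norm_inner_le_norm _ _).trans ?_)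
        refine mul_le_mul_of_nonneg_left ?_ (norm_nonneg _)
        calc ‖P.op S s (P.total (I \ P.hits I S s) s ψ)‖
            ≤ ‖P.op S s‖ * ((∏ j ∈ I \ P.hits I S s, P.majorant δ ρ wt j s) * ‖ψ‖) :=
              (ContinuousLinearMap.le_opNorm _ _).trans
                (mul_le_mul_of_nonneg_left (ih _ hss s hs) (norm_nonneg _))
          _ ≤ ‖P.op S s‖ *
              ((ρ ^ wt S * ∏ j ∈ I.erase l, P.majorant δ ρ wt j s) * ‖ψ‖) := by gcongr
          _ = (‖P.op S s‖ * ρ ^ wt S * ∏ j ∈ I.erase l, P.majorant δ ρ wt j s) * ‖ψ‖ := by ring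
          _ ≤ _ := by
            refine mul_le_mul_of_nonneg_right ?_ (norm_nonneg _)
            -- One hit location already pays for the whole insertion; the other summands are
            -- discarded.
            exact Finset.single_le_sum (f := fun l => ‖P.op S s‖ * ρ ^ wt S *
              ∏ j ∈ I.erase l, P.majorant δ ρ wt j s)
              (fun i _ => mul_nonneg (by positivity)
                (Finset.prod_nonneg fun j _ => hmaj0 s hs j)) hl
    · rw [total_zero]
      split_ifs with hI
      · simp [hI]
      · rw [norm_zero]
        exact mul_nonneg (Finset.prod_nonneg fun j _ => hmaj0 0 ⟨le_rfl, hT⟩ j) (norm_nonneg _)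

end Perturbation

/-! ### Strongly continuous families of unitaries. -/

section UnitaryFamily

variable {H : Type*} [NormedAddCommGroup H] [InnerProductSpace ℂ H]

lemma continuous_uncurry_of_norm_map {U : ℝ → H →L[ℂ] H} (hU : ∀ t ψ, ‖U t ψ‖ = ‖ψ‖)
    (hc : ∀ ψ, Continuous fun t => U t ψ) : Continuous fun p : ℝ × H => U p.1 p.2 := by
  refine continuous_iff_continuousAt.2 fun p => ?_
  refine tendsto_iff_norm_sub_tendsto_zero.2 ?_
  have h1 : Tendsto (fun q : ℝ × H => ‖q.2 - p.2‖ + ‖U q.1 p.2 - U p.1 p.2‖) (𝓝 p) (𝓝 0) := by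
    have h2 : Continuous fun q : ℝ × H => ‖q.2 - p.2‖ + ‖U q.1 p.2 - U p.1 p.2‖ :=
      (continuous_snd.sub continuous_const).norm.add
        (((hc p.2).comp continuous_fst).sub continuous_const).norm
    simpa using h2.tendsto p
  refine squeeze_zero (fun _ => norm_nonneg _) (fun q => ?_) h1
  calc ‖U q.1 q.2 - U p.1 p.2‖ = ‖U q.1 (q.2 - p.2) + (U q.1 p.2 - U p.1 p.2)‖ := by
        rw [map_sub]; congr 1; abel
    _ ≤ _ := (norm_add_le _ _).trans_eq (by rw [hU])

variable [CompleteSpace H]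

lemma adjoint_apply_apply_of_mem_unitary {V : H →L[ℂ] H} (hV : V ∈ unitary (H →L[ℂ] H)) (ψ : H) :
    V (ContinuousLinearMap.adjoint V ψ) = ψ :=
  congrArg (fun A : H →L[ℂ] H => A ψ) (Unitary.mul_star_self_of_mem hV)

lemma norm_adjoint_apply_of_mem_unitary {V : H →L[ℂ] H} (hV : V ∈ unitary (H →L[ℂ] H)) (ψ : H) :
    ‖ContinuousLinearMap.adjoint V ψ‖ = ‖ψ‖ := by
  rw [← ContinuousLinearMap.norm_map_of_mem_unitary hV, adjoint_apply_apply_of_mem_unitary hV]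

/-- Unitarity gives `‖U_t* ψ - U_s* ψ‖ = ‖ψ - U_t U_s* ψ‖`, which reduces continuity of the adjoints
to that of `U` on a fixed vector. -/
lemma continuous_adjoint_apply {U : ℝ → H →L[ℂ] H} (hU : ∀ t, U t ∈ unitary (H →L[ℂ] H))
    (hc : ∀ ψ, Continuous fun t => U t ψ) (ψ : H) :
    Continuous fun t => ContinuousLinearMap.adjoint (U t) ψ := by
  refine continuous_iff_continuousAt.2 fun s => ?_
  refine tendsto_iff_norm_sub_tendsto_zero.2 ?_
  set φ := ContinuousLinearMap.adjoint (U s) ψ with hφ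
  have h1 : Tendsto (fun t => ‖U s φ - U t φ‖) (𝓝 s) (𝓝 0) := by
    have h2 : Continuous fun t => ‖U s φ - U t φ‖ := (continuous_const.sub (hc φ)).norm
    simpa using h2.tendsto s
  refine h1.congr fun t => ?_
  change _ = ‖ContinuousLinearMap.adjoint (U t) ψ - φ‖
  rw [← ContinuousLinearMap.norm_map_of_mem_unitary (hU t) (_ - φ), map_sub,
    adjoint_apply_apply_of_mem_unitary (hU t), hφ, adjoint_apply_apply_of_mem_unitary (hU s)]

lemma stronglyMeasurable_adjoint_conj {U : ℝ → H →L[ℂ] H}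
    (hU : ∀ t, U t ∈ unitary (H →L[ℂ] H)) (hc : ∀ ψ, Continuous fun t => U t ψ)
    {A : ℝ → H →L[ℂ] H} (hA : StronglyMeasurable A) {Ω : Type*} [MeasurableSpace Ω] {τ : Ω → ℝ}
    {φ : Ω → H} (hτ : Measurable τ) (hφ : StronglyMeasurable φ) :
    StronglyMeasurable fun ω =>
      ContinuousLinearMap.adjoint (U (τ ω)) (A (τ ω) (U (τ ω) (φ ω))) := by
  have h0 : Continuous fun p : ℝ × H => U p.1 p.2 :=
    continuous_uncurry_of_norm_map
      (fun t => ContinuousLinearMap.norm_map_of_mem_unitary (hU t)) hc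
  have h1 : StronglyMeasurable fun ω => U (τ ω) (φ ω) :=
    h0.comp_stronglyMeasurable (hτ.stronglyMeasurable.prodMk hφ)
  have h2 : StronglyMeasurable fun ω => A (τ ω) (U (τ ω) (φ ω)) := by
    have hcont : Continuous fun p : (H →L[ℂ] H) × H => p.1 p.2 :=
      isBoundedBilinearMap_apply.continuous
    exact hcont.comp_stronglyMeasurable ((hA.comp_measurable hτ).prodMk h1)
  have h3 : Continuous fun p : ℝ × H => ContinuousLinearMap.adjoint (U p.1) p.2 :=
    continuous_uncurry_of_norm_map (U := fun t => ContinuousLinearMap.adjoint (U t))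
      (fun t => norm_adjoint_apply_of_mem_unitary (hU t))
      (continuous_adjoint_apply hU hc)
  have h4 : StronglyMeasurable fun ω => (τ ω, A (τ ω) (U (τ ω) (φ ω))) :=
    hτ.stronglyMeasurable.prodMk h2
  have h5 := h3.comp_stronglyMeasurable h4
  exact h5

end UnitaryFamily

/-! ### The noise model as a perturbation by skew-adjoint operators. -/

section Concrete

variable {Q L B : Type*} [Fintype Q] [DecidableEq Q] [NormedAddCommGroup B]
  [InnerProductSpace ℂ B] [CompleteSpace B]

namespace Noise

lemma norm_interactionPicture (N : Noise Q B) {U₀ : ℝ → JointOp Q B}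
    (hU : ∀ t, U₀ t ∈ unitary (JointOp Q B)) (S : Finset Q) (t : ℝ) :
    ‖interactionPicture N U₀ S t‖ = ‖N.coupling S t‖ := by
  unfold interactionPicture
  rw [CStarRing.norm_mul_mem_unitary _ (hU t)]
  exact CStarRing.norm_mem_unitary_mul _ (Unitary.star_mem (hU t))

lemma im_inner_interactionPicture (N : Noise Q B) (U₀ : ℝ → JointOp Q B) (S : Finset Q) (t : ℝ)
    (ψ : JointSpace Q B) : (inner ℂ ψ (interactionPicture N U₀ S t ψ)).im = 0 := by
  have h : inner ℂ ψ (interactionPicture N U₀ S t ψ) =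
      inner ℂ (U₀ t ψ) (N.coupling S t (U₀ t ψ)) := by
    change inner ℂ ψ (ContinuousLinearMap.adjoint (U₀ t) (N.coupling S t (U₀ t ψ))) = _
    rw [ContinuousLinearMap.adjoint_inner_right]
  rw [h, ← Complex.conj_eq_iff_im, inner_conj_symm]
  exact (N.coupling_selfAdjoint S t).isSymmetric _ _

/-- The perturbation by the terms of `H_SB` in the interaction picture. -/
noncomputable def perturbation (N : Noise Q B) (C : Circuit Q L) (U₀ : ℝ → JointOp Q B)
    (hU : ∀ t, U₀ t ∈ unitary (JointOp Q B)) (hc : ∀ ψ, Continuous fun t => U₀ t ψ) :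
    Perturbation {S : Finset Q // S.Nonempty} L (JointSpace Q B) where
  op S t := (-Complex.I) • interactionPicture N U₀ S t
  hit S t l := t ∈ C.window l ∧ ((S : Finset Q) ∩ C.qubits l).Nonempty
  bound := ∑ S, |(N.coupling_bounded S).choose|
  bound_nonneg := Finset.sum_nonneg fun _ _ => abs_nonneg _
  stronglyMeasurable_op S Ω _ τ φ hτ hφ :=
    (stronglyMeasurable_adjoint_conj hU hc (N.coupling_measurable S) hτ hφ).const_smul
      (-Complex.I)
  norm_op_le S t := by
    rw [norm_smul, norm_neg, Complex.norm_I, one_mul, N.norm_interactionPicture hU]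
    exact ((N.coupling_bounded S).choose_spec t).trans ((le_abs_self _).trans
      (Finset.single_le_sum (f := fun S : Finset Q => |(N.coupling_bounded S).choose|)
        (fun _ _ => abs_nonneg _) (Finset.mem_univ (S : Finset Q))))
  measurableSet_hit S l := by
    by_cases h : ((S : Finset Q) ∩ C.qubits l).Nonempty
    · simp only [h, and_true, Circuit.window]
      exact measurableSet_Ico
    · simp [h]

variable (N : Noise Q B) (C : Circuit Q L) {U₀ : ℝ → JointOp Q B}
  (hU : ∀ t, U₀ t ∈ unitary (JointOp Q B)) (hc : ∀ ψ, Continuous fun t => U₀ t ψ)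

lemma norm_perturbation_op (S : {S : Finset Q // S.Nonempty}) (t : ℝ) :
    ‖(N.perturbation C U₀ hU hc).op S t‖ = ‖N.coupling S t‖ := by
  change ‖(-Complex.I) • interactionPicture N U₀ S t‖ = _
  rw [norm_smul, norm_neg, Complex.norm_I, one_mul, N.norm_interactionPicture hU]

lemma dysonIntegrand_apply (w : Word Q) (t : Fin w.1 → ℝ) (ψ : JointSpace Q B) :
    dysonIntegrand C N U₀ w t ψ = U₀ C.T ((N.perturbation C U₀ hU hc).integrand w.2 t ψ) := by
  have h : ∀ (n : ℕ) (A : Fin n → JointOp Q B),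
      (List.ofFn fun j => (-Complex.I) • A j).reverse.prod =
        (-Complex.I) ^ n • (List.ofFn A).reverse.prod := by
    intro n A
    induction n with
    | zero => simp
    | succ n ih =>
      rw [List.ofFn_succ', List.ofFn_succ', List.concat_eq_append, List.reverse_append,
        List.concat_eq_append, List.reverse_append]
      simp only [List.reverse_cons, List.reverse_nil, List.nil_append, List.cons_append,
        List.prod_cons]
      rw [ih, smul_mul_smul_comm, pow_succ']
  unfold dysonIntegrand Perturbation.integrand
  change _ = U₀ C.T ((List.ofFn fun j =>
    (-Complex.I) • interactionPicture N U₀ (w.2 j) (t j)).reverse.prod ψ)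
  rw [h]
  simp

/-- The two sets differ only where some time equals `T`, a null set. -/
lemma faultyTimes_ae_eq (I : Finset L) (w : Word Q) :
    faultyTimes C I w =ᵐ[volume] (N.perturbation C U₀ hU hc).times I w.2 C.T := by
  have h : ∀ᵐ t : Fin w.1 → ℝ, ∀ j, t j ≠ C.T :=
    ae_all_iff.2 fun j => Measure.ae_eval_ne (α := fun _ => ℝ) (fun _ => volume) j C.T
  filter_upwards [h] with t ht
  refine propext ⟨fun h => ⟨h.1, fun j => ⟨(h.2.1 j).1, lt_of_le_of_ne (h.2.1 j).2 (ht j)⟩,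
    fun l hl => h.2.2 l hl⟩, fun h => ⟨h.1, fun j => ⟨(h.2.1 j).1, (h.2.1 j).2.le⟩,
    fun l hl => h.2.2 l hl⟩⟩

/-- Choose a qubit of `S` in each hit location. All these locations run at time `t`, so they share
no qubit and the choice is injective. -/
lemma card_hits_le (I : Finset L) (S : {S : Finset Q // S.Nonempty}) (t : ℝ) :
    ((N.perturbation C U₀ hU hc).hits I S t).card ≤ S.1.card - 1 + 1 := by
  rw [Nat.sub_add_cancel S.2.card_pos]
  have h : ∀ l, ∃ q, l ∈ (N.perturbation C U₀ hU hc).hits I S t →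
      t ∈ C.window l ∧ q ∈ S.1 ∧ q ∈ C.qubits l := by
    intro l
    obtain ⟨q₀, -⟩ := S.2
    by_cases hl : l ∈ (N.perturbation C U₀ hU hc).hits I S t
    · obtain ⟨-, h1, q, hq⟩ := (Perturbation.mem_hits _).1 hl
      exact ⟨q, fun _ => ⟨h1, Finset.mem_inter.1 hq⟩⟩
    · exact ⟨q₀, fun h => absurd h hl⟩
  choose f hf using h
  refine Finset.card_le_card_of_injOn f (fun l hl => (hf l hl).2.1) fun l hl l' hl' heq => ?_
  by_contra hne
  obtain ⟨h1, -, h2⟩ := hf l hl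
  obtain ⟨h1', -, h2'⟩ := hf l' hl'
  exact Set.disjoint_left.1 (C.disjoint l l' hne (f l) h2 (heq ▸ h2')) h1 h1'

variable [DecidableEq L] [Fintype L]

lemma isFaultSum (I : Finset L) : IsFaultSum C N U₀ I
    (U₀ C.T * (N.perturbation C U₀ hU hc).totalCLM I C.T_nonneg) := by
  unfold IsFaultSum
  intro ψ
  set P := N.perturbation C U₀ hU hc with hP
  have hint : ∀ w : Word Q, IntegrableOn (fun t => P.integrand w.2 t ψ) (faultyTimes C I w) :=
    fun w => (P.integrableOn_integrand I w.2 C.T ψ).congr_set_ae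
      (N.faultyTimes_ae_eq C hU hc I w)
  have hdy : ∀ w : Word Q, (fun t => dysonIntegrand C N U₀ w t ψ) =
      fun t => U₀ C.T (P.integrand w.2 t ψ) :=
    fun w => funext fun t => N.dysonIntegrand_apply C hU hc w t ψ
  simp only [hdy]
  refine ⟨fun w => (U₀ C.T).integrable_comp (hint w), ?_⟩
  have hterm : ∀ w : Word Q, ∫ t in faultyTimes C I w, U₀ C.T (P.integrand w.2 t ψ) =
      U₀ C.T (P.term I w.2 C.T ψ) := fun w => by
    rw [(U₀ C.T).integral_comp_comm (hint w), setIntegral_congr_set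
      (N.faultyTimes_ae_eq C hU hc I w)]
    rfl
  simp only [hterm]
  exact (U₀ C.T).hasSum (P.hasSum_term I C.T_nonneg ψ)

/-- The sum of the faults is dominated by the product of the majorants of the locations. -/
lemma norm_faultSum_le {δ ρ : ℝ} (hδ : 0 < δ) (hρ : 1 ≤ ρ) (hρδ : 1 ≤ ρ * δ) (I : Finset L) :
    ‖U₀ C.T * (N.perturbation C U₀ hU hc).totalCLM I C.T_nonneg‖ ≤
      ∏ l ∈ I, (N.perturbation C U₀ hU hc).majorant δ ρ (fun S => S.1.card - 1) l C.T := by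
  set P := N.perturbation C U₀ hU hc
  rw [CStarRing.norm_mem_unitary_mul _ (hU C.T)]
  refine ContinuousLinearMap.opNorm_le_bound _ (Finset.prod_nonneg fun l _ =>
    hδ.le.trans (Perturbation.le_majorant (zero_le_one.trans hρ) l C.T_nonneg)) fun ψ => ?_
  rw [Perturbation.totalCLM_apply]
  refine Perturbation.norm_total_le_prod_majorant hδ hρ hρδ (N.card_hits_le C hU hc)
    (fun S t φ => ?_) (fun S => ?_) C.T_nonneg ψ I C.T ⟨C.T_nonneg, le_rfl⟩
  · change (inner ℂ φ ((-Complex.I) • interactionPicture N U₀ S t φ)).re = 0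
    rw [inner_smul_right]
    simp [N.im_inner_interactionPicture]
  · simp only [norm_perturbation_op]
    exact (N.coupling_measurable S).norm.measurable

end Noise

end Concrete

/-! ### Coupling norms in terms of `α`. -/

lemma Circuit.maxDuration_nonneg {Q L : Type*} (C : Circuit Q L) : 0 ≤ C.maxDuration :=
  Real.iSup_nonneg fun l => sub_nonneg.2 (C.start_le_finish l)

lemma Circuit.duration_le {Q L : Type*} (C : Circuit Q L) [Finite L] (l : L) : C.finish l - C.start l ≤ C.maxDuration :=
  le_ciSup (Set.finite_range fun l => C.finish l - C.start l).bddAbove l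

section CouplingStrength

variable {Q L B : Type*} [Fintype Q] [DecidableEq Q] [NormedAddCommGroup B]
  [InnerProductSpace ℂ B] [CompleteSpace B] (C : Circuit Q L) (N : Noise Q B)

lemma exists_norm_tupleCoupling_le : ∃ K : ℝ, 0 ≤ K ∧ ∀ {k : ℕ} (i : Fin k → Q) (t : ℝ),
    ‖tupleCoupling N i t‖ ≤ K := by
  choose K hK using N.coupling_bounded
  refine ⟨∑ S, |K S|, Finset.sum_nonneg fun _ _ => abs_nonneg _, fun i t => ?_⟩
  unfold tupleCoupling
  split_ifs
  · exact (hK _ t).trans ((le_abs_self _).trans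
      (Finset.single_le_sum (f := fun S => |K S|) (fun _ _ => abs_nonneg _) (Finset.mem_univ _)))
  · rw [norm_zero]
    exact Finset.sum_nonneg fun _ _ => abs_nonneg _

lemma le_couplingStrength (n : ℕ) (i : Q) {t : ℝ} (ht : t ∈ Set.Icc 0 C.T) :
    (∑ f : Fin n → Q, ‖tupleCoupling N (Fin.cons i f : Fin (n + 1) → Q) t‖) * C.maxDuration ≤
      couplingStrength C N n := by
  obtain ⟨K, -, hK⟩ := exists_norm_tupleCoupling_le N
  refine le_ciSup (f := fun p : Q × Set.Icc (0 : ℝ) C.T => (∑ f : Fin n → Q,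
    ‖tupleCoupling N (Fin.cons p.1 f : Fin (n + 1) → Q) p.2‖) * C.maxDuration) ?_ (i, ⟨t, ht⟩)
  refine ⟨(∑ _f : Fin n → Q, K) * C.maxDuration, ?_⟩
  rintro _ ⟨p, rfl⟩
  exact mul_le_mul_of_nonneg_right (Finset.sum_le_sum fun f _ => hK _ _) C.maxDuration_nonneg

lemma couplingStrength_nonneg (n : ℕ) : 0 ≤ couplingStrength C N n :=
  Real.iSup_nonneg fun _ => mul_nonneg (Finset.sum_nonneg fun _ _ => norm_nonneg _)
    C.maxDuration_nonneg

lemma couplingStrength_eq_zero {n : ℕ} (hn : Fintype.card Q ≤ n) : couplingStrength C N n = 0 := by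
  have h : ∀ i : Fin (n + 1) → Q, ¬ Function.Injective i := fun i hi => by
    have := Fintype.card_le_of_injective i hi
    simp only [Fintype.card_fin] at this
    omega
  simp [couplingStrength, tupleCoupling, h]

lemma alpha_nonneg : 0 ≤ alpha C N :=
  Real.iSup_nonneg fun n => Real.rpow_nonneg (couplingStrength_nonneg C N n) _

lemma couplingStrength_le_alpha_pow (n : ℕ) : couplingStrength C N n ≤ alpha C N ^ (n + 1) := by
  have hnn : ∀ n, 0 ≤ couplingStrength C N n ^ (1 / ((n : ℝ) + 1)) :=
    fun n => Real.rpow_nonneg (couplingStrength_nonneg C N n) _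
  -- Only the orders `n < card Q` can be nonzero, so the supremum defining `alpha` is finite and not
  -- a default value.
  have hbdd : BddAbove (Set.range fun n : ℕ => couplingStrength C N n ^ (1 / ((n : ℝ) + 1))) := by
    refine ⟨∑ k ∈ Finset.range (Fintype.card Q),
      couplingStrength C N k ^ (1 / ((k : ℝ) + 1)), ?_⟩
    rintro _ ⟨k, rfl⟩
    by_cases hk : k < Fintype.card Q
    · exact Finset.single_le_sum
        (f := fun k : ℕ => couplingStrength C N k ^ (1 / ((k : ℝ) + 1)))
        (fun k _ => hnn k) (Finset.mem_range.2 hk)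
    · simp only
      rw [couplingStrength_eq_zero C N (not_lt.1 hk), Real.zero_rpow (by positivity)]
      exact Finset.sum_nonneg fun k _ => hnn k
  have h : couplingStrength C N n ^ (1 / ((n : ℝ) + 1)) ≤ alpha C N := le_ciSup hbdd n
  calc couplingStrength C N n = (couplingStrength C N n ^ (1 / ((n : ℝ) + 1))) ^ (n + 1) := by
        rw [← Real.rpow_natCast, ← Real.rpow_mul (couplingStrength_nonneg C N n)]
        push_cast
        rw [one_div_mul_cancel (by positivity), Real.rpow_one]
    _ ≤ _ := pow_le_pow_left₀ (hnn n) h _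

lemma factorial_mul_sum_le_sum_tupleCoupling (n : ℕ) (i : Q) (t : ℝ) :
    n.factorial * ∑ S with i ∈ S ∧ S.card = n + 1, ‖N.coupling S t‖ ≤
      ∑ f : Fin n → Q, ‖tupleCoupling N (Fin.cons i f : Fin (n + 1) → Q) t‖ := by
  classical
  let im : (Fin n → Q) → Finset Q :=
    fun f => Finset.univ.image (Fin.cons i f : Fin (n + 1) → Q)
  let F : Finset (Fin n → Q) :=
    Finset.univ.filter fun f => Function.Injective (Fin.cons i f : Fin (n + 1) → Q)
  have hmaps : ∀ f ∈ F, im f ∈ Finset.univ.filter fun S : Finset Q => i ∈ S ∧ S.card = n + 1 := by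
    intro f hf
    rw [Finset.mem_filter] at hf ⊢
    refine ⟨Finset.mem_univ _, Finset.mem_image.2 ⟨0, Finset.mem_univ _, rfl⟩, ?_⟩
    rw [Finset.card_image_of_injective _ hf.2, Finset.card_univ, Fintype.card_fin]
  calc (n.factorial : ℝ) * ∑ S with i ∈ S ∧ S.card = n + 1, ‖N.coupling S t‖
      ≤ ∑ S with i ∈ S ∧ S.card = n + 1, ∑ f ∈ F with im f = S,
          ‖tupleCoupling N (Fin.cons i f : Fin (n + 1) → Q) t‖ := by
        rw [Finset.mul_sum]
        refine Finset.sum_le_sum fun S hS => ?_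
        obtain ⟨-, hi, hcard⟩ := Finset.mem_filter.1 hS
        have hval : ∀ f ∈ F.filter (fun f => im f = S),
            ‖tupleCoupling N (Fin.cons i f : Fin (n + 1) → Q) t‖ = ‖N.coupling S t‖ := by
          intro f hf
          rw [Finset.mem_filter, Finset.mem_filter] at hf
          unfold tupleCoupling
          rw [if_pos hf.1.2]
          exact congrArg (fun S => ‖N.coupling S t‖) hf.2
        rw [Finset.sum_congr rfl hval, Finset.sum_const, nsmul_eq_mul]
        refine mul_le_mul_of_nonneg_right ?_ (norm_nonneg _)
        -- The bijections from `Fin n` to `S \ {i}` provide `n!` distinct tuples whose image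
        -- together with `i` is `S`.
        have hcard' : Fintype.card (Fin n) = Fintype.card (S.erase i) := by
          rw [Fintype.card_fin, Fintype.card_coe, Finset.card_erase_of_mem hi, hcard]
          rfl
        have hfact : (Finset.univ : Finset (Fin n ≃ S.erase i)).card = n.factorial := by
          rw [Finset.card_univ, Fintype.card_equiv (Fintype.equivOfCardEq hcard'),
            Fintype.card_fin]
        rw [← hfact, Nat.cast_le]
        refine Finset.card_le_card_of_injOn (fun e j => (e j : Q)) (fun e _ => ?_)
          fun e _ e' _ h => ?_
        · have hinj : Function.Injective (Fin.cons i fun j => (e j : Q) : Fin (n + 1) → Q) := by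
            refine Fin.cons_injective_iff.2 ⟨?_, Subtype.val_injective.comp e.injective⟩
            rintro ⟨j, hj⟩
            exact Finset.ne_of_mem_erase (e j).2 hj
          simp only [Finset.coe_filter, Set.mem_ofPred_eq, F, Finset.mem_filter,
            Finset.mem_univ, true_and]
          refine ⟨hinj, Finset.eq_of_subset_of_card_le (fun q hq => ?_) ?_⟩
          · obtain ⟨j, -, rfl⟩ := Finset.mem_image.1 hq
            induction j using Fin.cases with
            | zero => exact hi
            | succ j => exact Finset.mem_of_mem_erase (e j).2
          · rw [Finset.card_image_of_injective _ hinj, Finset.card_univ, Fintype.card_fin, hcard]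
        · ext j
          exact congrFun h j
    _ = ∑ f ∈ F, ‖tupleCoupling N (Fin.cons i f : Fin (n + 1) → Q) t‖ :=
        Finset.sum_fiberwise_of_maps_to hmaps _
    _ ≤ _ := Finset.sum_le_sum_of_subset_of_nonneg (Finset.subset_univ _)
        fun _ _ _ => norm_nonneg _

lemma maxDuration_mul_sum_coupling_le (n : ℕ) (i : Q) {t : ℝ} (ht : t ∈ Set.Icc 0 C.T) :
    C.maxDuration * ∑ S with i ∈ S ∧ S.card = n + 1, ‖N.coupling S t‖ ≤
      alpha C N ^ (n + 1) / n.factorial := by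
  rw [le_div_iff₀ (by positivity)]
  have h1 := mul_le_mul_of_nonneg_right (factorial_mul_sum_le_sum_tupleCoupling N n i t)
    C.maxDuration_nonneg
  have h2 := (le_couplingStrength C N n i ht).trans (couplingStrength_le_alpha_pow C N n)
  linarith

/-- Grouping by size `n + 1` leaves `α ∑ (α ρ) ^ n / n!`, a partial sum of the exponential series.
-/
lemma maxDuration_mul_weighted_sum_le {ρ : ℝ} (hρ : 0 ≤ ρ) (i : Q) {t : ℝ}
    (ht : t ∈ Set.Icc 0 C.T) :
    C.maxDuration * ∑ S with i ∈ S, ‖N.coupling S t‖ * ρ ^ (S.card - 1) ≤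
      alpha C N * Real.exp (alpha C N * ρ) := by
  have hα := alpha_nonneg C N
  have hmaps : ∀ S ∈ Finset.univ.filter (fun S : Finset Q => i ∈ S),
      S.card - 1 ∈ Finset.range (Fintype.card Q) := by
    intro S hS
    have h1 : 0 < S.card := Finset.card_pos.2 ⟨i, (Finset.mem_filter.1 hS).2⟩
    have h2 := S.card_le_univ
    rw [Finset.mem_range]
    omega
  rw [← Finset.sum_fiberwise_of_maps_to hmaps, Finset.mul_sum]
  calc ∑ n ∈ Finset.range (Fintype.card Q), C.maxDuration *
        ∑ S ∈ Finset.univ.filter (fun S : Finset Q => i ∈ S) with S.card - 1 = n,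
          ‖N.coupling S t‖ * ρ ^ (S.card - 1)
      ≤ ∑ n ∈ Finset.range (Fintype.card Q),
          alpha C N * ((alpha C N * ρ) ^ n / n.factorial) := by
        refine Finset.sum_le_sum fun n _ => ?_
        have h1 : ∑ S ∈ Finset.univ.filter (fun S : Finset Q => i ∈ S) with S.card - 1 = n,
            ‖N.coupling S t‖ * ρ ^ (S.card - 1) =
            (∑ S with i ∈ S ∧ S.card = n + 1, ‖N.coupling S t‖) * ρ ^ n := by
          rw [Finset.sum_mul, Finset.filter_filter]
          refine Finset.sum_congr (Finset.filter_congr fun S _ => ?_) fun S hS => ?_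
          · refine and_congr_right fun hi => ?_
            have : 0 < S.card := Finset.card_pos.2 ⟨i, hi⟩
            omega
          · rw [(Finset.mem_filter.1 hS).2.2]
            rfl
        rw [h1, ← mul_assoc]
        refine (mul_le_mul_of_nonneg_right (maxDuration_mul_sum_coupling_le C N n i ht)
          (by positivity)).trans_eq ?_
        ring
    _ = alpha C N * ∑ n ∈ Finset.range (Fintype.card Q),
          (alpha C N * ρ) ^ n / n.factorial := by rw [Finset.mul_sum]
    _ ≤ _ := mul_le_mul_of_nonneg_left (Real.sum_le_exp_of_nonneg (by positivity) _) hα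

end CouplingStrength

/-! ### The majorant of a single location. -/

namespace Noise

variable {Q L B : Type*} [Fintype Q] [DecidableEq Q] [NormedAddCommGroup B]
  [InnerProductSpace ℂ B] [CompleteSpace B] (N : Noise Q B) (C : Circuit Q L)
  {U₀ : ℝ → JointOp Q B} (hU : ∀ t, U₀ t ∈ unitary (JointOp Q B))
  (hc : ∀ ψ, Continuous fun t => U₀ t ψ)

lemma rate_eq_zero (ρ : ℝ) (wt : {S : Finset Q // S.Nonempty} → ℕ) {l : L} {t : ℝ}
    (ht : t ∉ C.window l) : (N.perturbation C U₀ hU hc).rate ρ wt l t = 0 :=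
  Finset.sum_eq_zero fun _ _ => if_neg fun h => ht h.1

lemma maxDuration_mul_rate_le {ρ : ℝ} (hρ : 0 ≤ ρ) {m : ℕ} {l : L} (hm : (C.qubits l).card ≤ m)
    {t : ℝ} (ht : t ∈ Set.Icc 0 C.T) :
    C.maxDuration * (N.perturbation C U₀ hU hc).rate ρ (fun S => S.1.card - 1) l t ≤
      m * (alpha C N * Real.exp (alpha C N * ρ)) := by
  classical
  have hα := alpha_nonneg C N
  -- Union bound: a set that hits the location contains at least one of its qubits.
  have h1 : (N.perturbation C U₀ hU hc).rate ρ (fun S => S.1.card - 1) l t ≤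
      ∑ i ∈ C.qubits l, ∑ S with i ∈ S, ‖N.coupling S t‖ * ρ ^ (S.card - 1) := by
    have h2 : (N.perturbation C U₀ hU hc).rate ρ (fun S => S.1.card - 1) l t ≤
        ∑ S : {S : Finset Q // S.Nonempty}, ∑ i ∈ C.qubits l,
          if i ∈ S.1 then ‖N.coupling S t‖ * ρ ^ (S.1.card - 1) else 0 := by
      refine Finset.sum_le_sum fun S _ => ?_
      have hnn : ∀ i ∈ C.qubits l,
          0 ≤ if i ∈ S.1 then ‖N.coupling S t‖ * ρ ^ (S.1.card - 1) else 0 := fun i _ => by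
        split_ifs <;> positivity
      split_ifs with hh
      · obtain ⟨-, i, hi⟩ := hh
        obtain ⟨hiS, hil⟩ := Finset.mem_inter.1 hi
        refine le_trans (le_of_eq ?_) (Finset.single_le_sum hnn hil)
        rw [if_pos hiS, N.norm_perturbation_op C hU hc]
      · exact Finset.sum_nonneg hnn
    refine h2.trans ?_
    rw [Finset.sum_comm]
    refine Finset.sum_le_sum fun i _ => ?_
    rw [Finset.sum_filter]
    refine (Finset.sum_map Finset.univ (Function.Embedding.subtype fun S : Finset Q => S.Nonempty)
      fun S => if i ∈ S then ‖N.coupling S t‖ * ρ ^ (S.card - 1) else 0).symm.le.trans ?_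
    refine Finset.sum_le_sum_of_subset_of_nonneg (Finset.subset_univ _) fun S _ _ => ?_
    split_ifs <;> positivity
  calc C.maxDuration * (N.perturbation C U₀ hU hc).rate ρ (fun S => S.1.card - 1) l t
      ≤ ∑ i ∈ C.qubits l, C.maxDuration *
          ∑ S with i ∈ S, ‖N.coupling S t‖ * ρ ^ (S.card - 1) := by
        rw [← Finset.mul_sum]
        exact mul_le_mul_of_nonneg_left h1 C.maxDuration_nonneg
    _ ≤ ∑ _i ∈ C.qubits l, alpha C N * Real.exp (alpha C N * ρ) :=
        Finset.sum_le_sum fun i _ => maxDuration_mul_weighted_sum_le C N hρ i ht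
    _ ≤ _ := by
        rw [Finset.sum_const, nsmul_eq_mul]
        have : ((C.qubits l).card : ℝ) ≤ m := by exact_mod_cast hm
        gcongr

lemma majorant_le [Finite L] {δ ρ : ℝ} (hρ : 0 ≤ ρ) {m : ℕ} {l : L}
    (hm : (C.qubits l).card ≤ m) :
    (N.perturbation C U₀ hU hc).majorant δ ρ (fun S => S.1.card - 1) l C.T ≤
      δ + m * (alpha C N * Real.exp (alpha C N * ρ)) := by
  set c := m * (alpha C N * Real.exp (alpha C N * ρ)) with hcdef
  have hα := alpha_nonneg C N
  have hc0 : 0 ≤ c := by positivity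
  have hdur := C.duration_le l
  refine add_le_add le_rfl ?_
  rw [intervalIntegral.integral_of_le C.T_nonneg]
  have hle : ∀ t ∈ Set.Ioc 0 C.T,
      (N.perturbation C U₀ hU hc).rate ρ (fun S => S.1.card - 1) l t ≤
        (C.window l).indicator (fun _ => c / C.maxDuration) t := by
    intro t ht
    by_cases hw : t ∈ C.window l
    -- A time inside a window forces the maximal duration to be positive, so the division is
    -- legitimate.
    · rw [Set.indicator_of_mem hw, le_div_iff₀' (by linarith [hw.1, hw.2])]
      exact N.maxDuration_mul_rate_le C hU hc hρ hm ⟨ht.1.le, ht.2⟩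
    · rw [Set.indicator_of_notMem hw, N.rate_eq_zero C hU hc _ _ hw]
  have hind : Integrable ((C.window l).indicator fun _ => c / C.maxDuration) :=
    (integrable_indicator_iff measurableSet_Ico).2 (integrableOn_const (by simp))
  have hnn : ∀ t, 0 ≤ (C.window l).indicator (fun _ => c / C.maxDuration) t :=
    fun t => Set.indicator_nonneg (fun _ _ => div_nonneg hc0 C.maxDuration_nonneg) t
  calc ∫ t in Set.Ioc 0 C.T, (N.perturbation C U₀ hU hc).rate ρ (fun S => S.1.card - 1) l t
      ≤ ∫ t in Set.Ioc 0 C.T, (C.window l).indicator (fun _ => c / C.maxDuration) t := by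
        refine integral_mono_of_nonneg (ae_of_all _ fun t => Perturbation.rate_nonneg hρ l t)
          hind.integrableOn ?_
        exact (ae_restrict_iff' measurableSet_Ioc).2 (ae_of_all _ hle)
    _ ≤ ∫ t, (C.window l).indicator (fun _ => c / C.maxDuration) t :=
        setIntegral_le_integral hind (ae_of_all _ hnn)
    _ = (C.finish l - C.start l) * (c / C.maxDuration) := by
        rw [integral_indicator (by exact measurableSet_Ico), setIntegral_const, Circuit.window,
          Real.volume_real_Ico_of_le (C.start_le_finish l), smul_eq_mul]
    _ ≤ C.maxDuration * (c / C.maxDuration) :=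
        mul_le_mul_of_nonneg_right hdur (div_nonneg hc0 C.maxDuration_nonneg)
    _ ≤ c := by
        -- If all durations vanish, the left side is `0`, and `c ≥ 0` suffices.
        rcases eq_or_ne C.maxDuration 0 with h0 | h0
        · simpa [h0] using hc0
        · exact (mul_div_cancel₀ c h0).le

end Noise

/-! ### Numerical estimates for the final constant. -/

/-- This is `1 + x ≤ e^x` at `x = (e - 1) / 2`; the exponent `C(α) ≥ 1` only enlarges a base that is
at least `1`. -/
lemma mul_one_add_exp_le_strengthBound (m : ℕ) {a : ℝ} (ha : 0 ≤ a) (ha' : 2 * a < 1) :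
    m * a * (1 + Real.exp 1) ≤ strengthBound m a := by
  have h1 : (1 + Real.exp 1) / 2 ≤ Real.exp ((Real.exp 1 - 1) / 2) := by
    linarith [Real.add_one_le_exp ((Real.exp 1 - 1) / 2)]
  have h2 : 1 ≤ Real.exp ((Real.exp 1 - 1) / 2) := by
    linarith [Real.add_one_le_exp (1 : ℝ)]
  have h3 : Real.exp ((Real.exp 1 - 1) / 2) ≤
      Real.exp ((Real.exp 1 - 1) / 2) ^ (1 - 2 * a)⁻¹ := by
    refine (Real.rpow_one _).symm.le.trans (Real.rpow_le_rpow_of_exponent_le h2 ?_)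
    exact (one_le_inv₀ (by linarith)).2 (by linarith)
  have h4 : (1 + Real.exp 1) ≤ 2 * Real.exp ((Real.exp 1 - 1) / 2) ^ (1 - 2 * a)⁻¹ := by
    linarith
  calc m * a * (1 + Real.exp 1) ≤
      m * a * (2 * Real.exp ((Real.exp 1 - 1) / 2) ^ (1 - 2 * a)⁻¹) := by gcongr
    _ = strengthBound m a := by unfold strengthBound; ring

lemma tendsto_strengthBound_div (m : ℕ) :
    Tendsto (fun a : ℝ => strengthBound m a / a) (𝓝[>] 0)
      (𝓝 (2 * Real.exp ((Real.exp 1 - 1) / 2) * m)) := by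
  have hpos := Real.exp_pos ((Real.exp 1 - 1) / 2)
  have hcont : ContinuousAt
      (fun a : ℝ => 2 * Real.exp ((Real.exp 1 - 1) / 2) ^ (1 - 2 * a)⁻¹ * m) 0 := by
    refine ContinuousAt.mul (ContinuousAt.mul continuousAt_const ?_) continuousAt_const
    refine ContinuousAt.rpow continuousAt_const ?_ (Or.inl hpos.ne')
    exact ContinuousAt.inv₀ (by fun_prop) (by norm_num)
  have h := hcont.tendsto
  simp only [mul_zero, sub_zero, inv_one, Real.rpow_one] at h
  refine (h.mono_left nhdsWithin_le_nhds).congr' ?_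
  filter_upwards [self_mem_nhdsWithin] with a ha
  have ha' : a ≠ 0 := (Set.mem_Ioi.1 ha).ne'
  unfold strengthBound
  field_simp

lemma abs_two_mul_exp_sub_lt : |2 * Real.exp ((Real.exp 1 - 1) / 2) - 4.72| < 0.005 := by
  have h1 := Real.exp_one_gt_d9
  have h2 := Real.exp_one_lt_d9
  -- `(e - 1) / 2 = 0.85914…`; seven Taylor terms suffice at the rational endpoints.
  have h3 : Real.exp ((Real.exp 1 - 1) / 2) ≤ Real.exp 0.8592 := Real.exp_le_exp.2 (by linarith)
  have h4 : Real.exp 0.8591 ≤ Real.exp ((Real.exp 1 - 1) / 2) := Real.exp_le_exp.2 (by linarith)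
  have h5 := Real.exp_bound' (x := 0.8592) (by norm_num) (by norm_num) (n := 7) (by norm_num)
  have h6 := Real.sum_le_exp_of_nonneg (x := 0.8591) (by norm_num) 7
  norm_num [Finset.sum_range_succ, Nat.factorial] at h5 h6
  rw [abs_lt]
  constructor <;> linarith

end CorrelatedNoise

/-! ### Choice of the parameters and conclusion. -/

open CorrelatedNoise in
theorem corollary1 {Q L B : Type*} [Fintype Q] [DecidableEq Q] [Fintype L]
    [NormedAddCommGroup B] [InnerProductSpace ℂ B] [CompleteSpace B]
    (C : Circuit Q L) (N : Noise Q B) (U₀ : ℝ → JointOp Q B)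
    (hU₀ : IsEvolution (fun t => freeHamiltonian (C.systemHamiltonian t) (N.bath t)) U₀)
    (m : ℕ) (hm : ∀ l, (C.qubits l).card ≤ m) (hα : 2 * alpha C N < 1) :
    HasEffectiveNoiseStrength C N U₀ (strengthBound m (alpha C N)) ∧
      (Tendsto (fun a : ℝ => strengthBound m a / a) (𝓝[>] 0)
          (𝓝 (2 * Real.exp ((Real.exp 1 - 1) / 2) * m)) ∧
        |2 * Real.exp ((Real.exp 1 - 1) / 2) - 4.72| < 0.005) := by
  classical
  refine ⟨fun I => ?_, tendsto_strengthBound_div m, abs_two_mul_exp_sub_lt⟩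
  have hU := hU₀.unitary_mem
  have hc := hU₀.continuous
  refine ⟨_, N.isFaultSum C hU hc I, ?_⟩
  set E := U₀ C.T * (N.perturbation C U₀ hU hc).totalCLM I C.T_nonneg
  set α := alpha C N with hαdef
  have hα0 : 0 ≤ α := alpha_nonneg C N
  -- The strict inequality keeps `δ` positive even when `m α = 0`; the limit `δ ↓ m α` is taken
  -- afterwards.
  have hbound : ∀ δ, m * α < δ → ‖E‖ ≤ (δ * (1 + Real.exp 1)) ^ I.card := by
    intro δ hδ
    have hδ0 : 0 < δ := lt_of_le_of_lt (by positivity) hδ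
    -- `ρ = max 1 δ⁻¹` is the smallest weight with `ρ ≥ 1` and `ρ δ ≥ 1`.
    have hρ0 : 0 ≤ max 1 δ⁻¹ := zero_le_one.trans (le_max_left _ _)
    have hρδ : 1 ≤ max 1 δ⁻¹ * δ := by
      calc 1 = δ⁻¹ * δ := (inv_mul_cancel₀ hδ0.ne').symm
        _ ≤ _ := by gcongr; exact le_max_right _ _
    refine (N.norm_faultSum_le C hU hc hδ0 (le_max_left 1 δ⁻¹) hρδ I).trans ?_
    rw [← Finset.prod_const]
    refine Finset.prod_le_prod (fun l _ => hδ0.le.trans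
      (Perturbation.le_majorant hρ0 l C.T_nonneg)) fun l _ => ?_
    refine (N.majorant_le C hU hc hρ0 (hm l)).trans ?_
    have hexp : m * (α * Real.exp (α * max 1 δ⁻¹)) ≤ m * (α * Real.exp 1) := by
      rcases Nat.eq_zero_or_pos m with rfl | hmpos
      · simp
      · have hm1 : (1 : ℝ) ≤ m := by exact_mod_cast hmpos
        have hαδ : α ≤ δ := by nlinarith
        -- Both `α ≤ 1` and `α ≤ m α < δ` enter, so the exponential is at most `e`.
        have h1 : α * max 1 δ⁻¹ ≤ 1 := by
          rw [mul_max_of_nonneg _ _ hα0, mul_one, ← div_eq_mul_inv]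
          exact max_le (by linarith) ((div_le_one hδ0).2 hαδ)
        gcongr
    nlinarith [Real.exp_pos 1]
  have hlim : ‖E‖ ≤ (m * α * (1 + Real.exp 1)) ^ I.card := by
    have hcont : Continuous fun δ : ℝ => (δ * (1 + Real.exp 1)) ^ I.card := by fun_prop
    refine ge_of_tendsto ((hcont.tendsto (m * α)).mono_left
      (nhdsWithin_le_nhds (s := Set.Ioi (m * α)))) ?_
    filter_upwards [self_mem_nhdsWithin] with δ hδ
    exact hbound δ hδ
  exact hlim.trans (pow_le_pow_left₀ (by positivity)
    (mul_one_add_exp_le_strengthBound m hα0 hα) _)
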